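/- Let $\mathcal G=\mathbb C^4$, with coordinates $(a,b,x,y)$, be the symplectic groupoid of the holomorphic Poisson structure $\Pi=x\,\partial_x\wedge\partial_y$ on $\mathbb C^2$, with source $s(a,b,x,y)=(x,y)$, target $t(a,b,x,y)=(e^a x,\,y+xb)$ and symplectic form $\Omega=da\wedge d(y+xb)-db\wedge dx$; thus $\Omega=t^*\omega-s^*\omega$ where $x\neq 0$, with $\omega=x^{-1}dx\wedge dy$. In the global coordinates $(p_1,p_2,q_1,q_2)=(a,-b,y+xb,x)$ one has $\Omega=dp_1\wedge dq_1+dp_2\wedge dq_2$. Let $C>1$ and $$K(q_1,q_2)=\frac{|q_1|^2}{C}-\mathrm{Li}_2(-|q_2|^2),\qquad \mathrm{Li}_2(z)=-\int_0^z\log(1-u)\,\frac{du}{u}.$$ Then $K$ is smooth on $\mathbb C^2=\mathbb R^4$, and $$\alpha=\frac{\partial^2K}{\partial q_1\partial\bar q_1}=\frac1C,\qquad \beta=\frac{\partial^2K}{\partial q_2\partial\bar q_2}=\frac1{1+|q_2|^2}.$$ The graph $\mathcal L=\{p_j=-i\,\partial K/\partial q_j\}$ is a brane bisection of $\mathcal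 G$: it is Lagrangian for $\operatorname{Im}\Omega$, and $t|_{\mathcal L}$, $s|_{\mathcal L}$ are diffeomorphisms onto $\mathbb C^2$. In the coordinates $(q_1,q_2)$ of $\mathcal L\cong\mathbb R^4$, the form $F=\Omega|_{\mathcal L}$ equals $i\partial\bar\partial K$ and is a real symplectic form. Let $I_+$ and $I_-$ be the complex structures on $\mathbb R^4$ obtained by pulling back that of $\mathbb C^2$ along $t|_{\mathcal L}$ and $s|_{\mathcal L}$. The pullbacks of the real Poisson structure $-4\operatorname{Im}\Pi$ along $t|_{\mathcal L}$ and $s|_{\mathcal L}$ coincide; call the result $Q$. Here two-forms are read as maps $X\mapsto B(X,\cdot)$, and bivectors as the maps $\zeta\mapsto Q(\cdot,\zeta)$, so that $\Pi$ is inverse to $\omega$. Then $$I_+-I_-=QF,\qquad FI_++I_-^*F=0.$$ Put $g=-\tfrac12F(I_++I_-)$, $b=-\tfrac12F(I_+-I_-)$ and $\omega_\pm=gI_\pm$. The tensor $g$ is a Riemannian metric on $\mathbb R^4$, given by $$g=2\Big(\frac1C\,dq_1d\bar q_1+\frac1{1+|q_2|^2}\big(dq_2d\bar q_2+\tfrac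 iC\,\bar q_2\,dq_1dq_2-\tfrac iC\,q_2\,d\bar q_1d\bar q_2\big)\Big).$$ The endomorphisms of $T\oplus T^*$ $$\mathbb J_{\mathcal A}=\tfrac12e^b\begin{pmatrix}I_+-I_-&-(\omega_+^{-1}+\omega_-^{-1})\\ \omega_++\omega_-&-(I_+^*-I_-^*)\end{pmatrix}e^{-b},\qquad \mathbb J_{\mathcal B}=\tfrac12e^b\begin{pmatrix}I_++I_-&-(\omega_+^{-1}-\omega_-^{-1})\\ \omega_+-\omega_-&-(I_+^*+I_-^*)\end{pmatrix}e^{-b},\qquad e^{b}=\begin{pmatrix}1&0\\ b&1\end{pmatrix},$$ form a generalized Kähler structure on $\mathbb R^4$: they are commuting generalized complex structures (orthogonal, of square $-1$, with $+i$-eigenbundle closed under the Courant bracket) and $\langle -\mathbb J_{\mathcal A}\mathbb J_{\mathcal B}v,v\rangle>0$ for $v\neq0$. It is of symplectic type: $\mathbb J_{\mathcal A}=\begin{pmatrix}0&-F^{-1}\\F&0\end{pmatrix}$. The metric $g$ is complete, although $Q$ is not of constant rank: it has rank $4$ where $q_2\neq0$ and vanishes where $q_2=0$. -/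

import Mathlib

open scoped ContDiff Manifold

noncomputable section

namespace GenKahler

/-! ### Generalized geometry on a real vector space

Tensor fields on the manifold `E` are written through the identification of every tangent space
with `E`.  Sections of `TM ⊕ T*M` are maps `E → E × (E →L[ℝ] ℝ)`, a bilinear form is the
corresponding map `T → T*`, `X ↦ i_X B = B(X, ·)`. -/

section Generalized

variable {E : Type*} [NormedAddCommGroup E] [NormedSpace ℝ E]

/-- The fibre `T ⊕ T*`. -/
abbrev GTangent (E : Type*) [NormedAddCommGroup E] [NormedSpace ℝ E] : Type _ :=
  E × (E →L[ℝ] ℝ)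

/-- `⟨X + ξ, Y + η⟩ = (ξ(Y) + η(X)) / 2`. -/
def gpairing (u v : GTangent E) : ℝ := (1 / 2 : ℝ) * (u.2 v.1 + v.2 u.1)

/-- The Lie derivative `L_X η` of a one-form: `v ↦ (X·η)(v) + η(D_v X)`. -/
def lieDerivForm (X : E → E) (η : E → (E →L[ℝ] ℝ)) (q : E) : E →L[ℝ] ℝ :=
  fderiv ℝ η q (X q) + (η q).comp (fderiv ℝ X q)

/-- The contraction `ι_Y dξ`, where `dξ(v, w) = (D_v ξ)(w) - (D_w ξ)(v)`. -/
def contractExtDeriv (Y : E → E) (ξ : E → (E →L[ℝ] ℝ)) (q : E) : E →L[ℝ] ℝ :=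
  fderiv ℝ ξ q (Y q) - (fderiv ℝ ξ q).flip (Y q)

/-- The Courant bracket `[X + ξ, Y + η] = [X, Y] + L_X η - ι_Y dξ`. -/
def courant (u v : E → GTangent E) (q : E) : GTangent E :=
  (VectorField.lieBracket ℝ (fun p => (u p).1) (fun p => (v p).1) q,
    lieDerivForm (fun p => (u p).1) (fun p => (v p).2) q
      - contractExtDeriv (fun p => (v p).1) (fun p => (u p).2) q)

/-- The complex section `u₁ + i u₂` of `(T ⊕ T*) ⊗ ℂ` takes values in the `+i`-eigenbundle. -/
def InEigenbundle (J : E → GTangent E →L[ℝ] GTangent E) (u₁ u₂ : E → GTangent E) : Prop :=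
  ∀ q, J q (u₁ q) = -u₂ q ∧ J q (u₂ q) = u₁ q

/-- A generalized complex structure on the manifold `E`. -/
structure IsGeneralizedComplex (J : E → GTangent E →L[ℝ] GTangent E) : Prop where
  smooth : ContDiff ℝ ∞ J
  sq_eq_neg : ∀ q v, J q (J q v) = -v
  orthogonal : ∀ q v w, gpairing (J q v) (J q w) = gpairing v w
  /-- The `+i`-eigenbundle is closed under the complexified bracket: the bracket of two smooth
  sections `u₁ + i u₂`, `v₁ + i v₂` of it is again a section of it. -/
  involutive : ∀ u₁ u₂ v₁ v₂ : E → GTangent E,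
    ContDiff ℝ ∞ u₁ → ContDiff ℝ ∞ u₂ → ContDiff ℝ ∞ v₁ → ContDiff ℝ ∞ v₂ →
    InEigenbundle J u₁ u₂ → InEigenbundle J v₁ v₂ →
    InEigenbundle J (fun q => courant u₁ v₁ q - courant u₂ v₂ q)
      (fun q => courant u₁ v₂ q + courant u₂ v₁ q)

/-- A generalized Kähler structure: a commuting pair of generalized complex structures such that
`G = -J_A J_B` satisfies `⟨G v, v⟩ > 0` for all `v ≠ 0`. -/
structure IsGeneralizedKahler (JA JB : E → GTangent E →L[ℝ] GTangent E) : Prop where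
  left : IsGeneralizedComplex JA
  right : IsGeneralizedComplex JB
  commute : ∀ q v, JA q (JB q v) = JB q (JA q v)
  positive : ∀ q v, v ≠ 0 → 0 < gpairing (-(JA q (JB q v))) v

/-- The endomorphism of `T ⊕ T*` with block matrix `(A B; C D)`. -/
def block (A : E →L[ℝ] E) (B : (E →L[ℝ] ℝ) →L[ℝ] E) (C : E →L[ℝ] (E →L[ℝ] ℝ))
    (D : (E →L[ℝ] ℝ) →L[ℝ] (E →L[ℝ] ℝ)) : GTangent E →L[ℝ] GTangent E :=
  (A.coprod B).prod (C.coprod D)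

/-- The transpose `A* ξ = ξ ∘ A`. -/
def transpose {E' : Type*} [NormedAddCommGroup E'] [NormedSpace ℝ E'] (A : E →L[ℝ] E') :
    (E' →L[ℝ] ℝ) →L[ℝ] (E →L[ℝ] ℝ) :=
  (ContinuousLinearMap.compL ℝ E E' ℝ).flip A

/-- `e^b = (1 0; b 1)`. -/
def expB (b : E →L[ℝ] (E →L[ℝ] ℝ)) : GTangent E →L[ℝ] GTangent E :=
  block (ContinuousLinearMap.id ℝ E) 0 b (ContinuousLinearMap.id ℝ _)

/-- The endomorphism `J_B` of the data `(g, I₊, I₋, b)`, with `ω_± = g I_±`: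
`½ e^b (I₊ + I₋, -(ω₊⁻¹ - ω₋⁻¹); ω₊ - ω₋, -(I₊* + I₋*)) e^{-b}`. -/
def gualtieriB (g b : E → E →L[ℝ] (E →L[ℝ] ℝ)) (Ip Im : E → E →L[ℝ] E) (q : E) :
    GTangent E →L[ℝ] GTangent E :=
  let ωp := (g q).comp (Ip q)
  let ωm := (g q).comp (Im q)
  (1 / 2 : ℝ) • ((expB (b q)).comp
    ((block (Ip q + Im q) (-(ωp.inverse - ωm.inverse)) (ωp - ωm)
      (-(transpose (Ip q) + transpose (Im q)))).comp (expB (-(b q)))))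

/-- The endomorphism `J_A` of the data `(g, I₊, I₋, b)`:
`½ e^b (I₊ - I₋, -(ω₊⁻¹ + ω₋⁻¹); ω₊ + ω₋, -(I₊* - I₋*)) e^{-b}`. -/
def gualtieriA (g b : E → E →L[ℝ] (E →L[ℝ] ℝ)) (Ip Im : E → E →L[ℝ] E) (q : E) :
    GTangent E →L[ℝ] GTangent E :=
  let ωp := (g q).comp (Ip q)
  let ωm := (g q).comp (Im q)
  (1 / 2 : ℝ) • ((expB (b q)).comp
    ((block (Ip q - Im q) (-(ωp.inverse + ωm.inverse)) (ωp + ωm)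
      (-(transpose (Ip q) - transpose (Im q)))).comp (expB (-(b q)))))

/-- The endomorphism `(0, -F⁻¹; F, 0)` of a nondegenerate two-form. -/
def symplecticGC (F : E → E →L[ℝ] (E →L[ℝ] ℝ)) (q : E) : GTangent E →L[ℝ] GTangent E :=
  block 0 (-(F q).inverse) (F q) 0

/-- A symplectic form: a smooth, skew, closed and nondegenerate bilinear form. -/
structure IsSymplecticForm (F : E → E →L[ℝ] (E →L[ℝ] ℝ)) : Prop where
  smooth : ContDiff ℝ ∞ F
  skew : ∀ q u v, F q u v = -F q v u
  closed : ∀ q u v w, fderiv ℝ F q u v w + fderiv ℝ F q v w u + fderiv ℝ F q w u v = 0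
  nondegenerate : ∀ q, Function.Bijective (F q)

/-- A Riemannian metric on the manifold `E` (finite dimensional in the application). -/
structure IsRiemannianMetric (g : E → E →L[ℝ] (E →L[ℝ] ℝ)) : Prop where
  smooth : ContDiff ℝ ∞ g
  symm : ∀ q u v, g q u v = g q v u
  pos : ∀ q u, u ≠ 0 → 0 < g q u u

/-- The Riemannian distance: infimum of the `g`-lengths of `C¹` paths. -/
def metricEDist (g : E → E →L[ℝ] (E →L[ℝ] ℝ)) (x y : E) : ENNReal :=
  letI : ∀ z : E, ENorm (TangentSpace 𝓘(ℝ, E) z) :=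
    fun z => ⟨fun v : E => ENNReal.ofReal (Real.sqrt (g z v v))⟩
  Manifold.riemannianEDist 𝓘(ℝ, E) x y

/-- Completeness: every Cauchy sequence of the Riemannian distance converges for it. -/
def IsCompleteMetric (g : E → E →L[ℝ] (E →L[ℝ] ℝ)) : Prop :=
  ∀ u : ℕ → E,
    (∀ ε : ENNReal, 0 < ε → ∃ N, ∀ m ≥ N, ∀ n ≥ N, metricEDist g (u m) (u n) < ε) →
    ∃ x : E, Filter.Tendsto (fun n => metricEDist g (u n) x) Filter.atTop (nhds 0)

end Generalized

/-! ### The symplectic groupoid of `x ∂_x ∧ ∂_y`, its Darboux chart and its branes -/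

/-- `ℂ² = ℝ⁴`. -/
abbrev C2 : Type := ℂ × ℂ

/-- The groupoid `ℂ⁴`, with coordinates `(a, b, x, y)`. -/
abbrev Gpd : Type := ℂ × ℂ × ℂ × ℂ

/-- The source `s(a, b, x, y) = (x, y)`. -/
def source (z : Gpd) : C2 := (z.2.2.1, z.2.2.2)

/-- The target `t(a, b, x, y) = (eᵃ x, y + x b)`. -/
def target (z : Gpd) : C2 := (Complex.exp z.1 * z.2.2.1, z.2.2.2 + z.2.2.1 * z.2.1)

/-- The holomorphic two-form `α ∧ β` of two one-forms: `(u, v) ↦ α(u) β(v) - β(u) α(v)`. -/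
def wedge {V : Type*} [NormedAddCommGroup V] [NormedSpace ℂ V] (α β : V →L[ℂ] ℂ) :
    V →L[ℂ] V →L[ℂ] ℂ :=
  α.smulRight β - β.smulRight α

/-- `Ω = da ∧ d(y + x b) - db ∧ dx`. -/
def groupoidForm (z : Gpd) : Gpd →L[ℂ] Gpd →L[ℂ] ℂ :=
  wedge (fderiv ℂ (fun w : Gpd => w.1) z) (fderiv ℂ (fun w : Gpd => w.2.2.2 + w.2.2.1 * w.2.1) z)
    - wedge (fderiv ℂ (fun w : Gpd => w.2.1) z) (fderiv ℂ (fun w : Gpd => w.2.2.1) z)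

/-- The meromorphic symplectic form `x⁻¹ dx ∧ dy` on `ℂ²`, inverse to `x ∂_x ∧ ∂_y`
where `x ≠ 0`. -/
def meromorphicForm (z : C2) : C2 →L[ℂ] C2 →L[ℂ] ℂ :=
  (z.1)⁻¹ • wedge (ContinuousLinearMap.fst ℂ ℂ ℂ) (ContinuousLinearMap.snd ℂ ℂ ℂ)

/-- The Darboux chart `(p₁, p₂, q₁, q₂) = (a, -b, y + x b, x)`. -/
def darboux (z : Gpd) : Gpd := (z.1, -z.2.1, z.2.2.2 + z.2.2.1 * z.2.1, z.2.2.1)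

/-- The point of the groupoid with Darboux coordinates `(p₁, p₂, q₁, q₂)`. -/
def darbouxInv (w : Gpd) : Gpd := (w.1, -w.2.1, w.2.2.2, w.2.2.1 + w.2.1 * w.2.2.2)

/-- The standard form `dp₁ ∧ dq₁ + dp₂ ∧ dq₂`. -/
def canonicalForm (w : Gpd) : Gpd →L[ℂ] Gpd →L[ℂ] ℂ :=
  wedge (fderiv ℂ (fun z : Gpd => z.1) w) (fderiv ℂ (fun z : Gpd => z.2.2.1) w)
    + wedge (fderiv ℂ (fun z : Gpd => z.2.1) w) (fderiv ℂ (fun z : Gpd => z.2.2.2) w)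

theorem darbouxInv_darboux (z : Gpd) : darbouxInv (darboux z) = z := by
  obtain ⟨a, b, x, y⟩ := z
  simp only [darboux, darbouxInv, neg_neg, Prod.mk.injEq, true_and]
  ring

theorem darboux_darbouxInv (w : Gpd) : darboux (darbouxInv w) = w := by
  obtain ⟨p₁, p₂, q₁, q₂⟩ := w
  simp only [darboux, darbouxInv, neg_neg, Prod.mk.injEq, true_and, and_true]
  ring

/-- The Wirtinger derivative in the complex direction `e`; `dWirt (1, 0) = ∂/∂q₁` and
`dWirt (0, 1) = ∂/∂q₂`. -/
def dWirt (e : C2) (f : C2 → ℂ) (q : C2) : ℂ :=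
  (1 / 2 : ℂ) * (fderiv ℝ f q e - Complex.I * fderiv ℝ f q (Complex.I • e))

/-- The conjugate Wirtinger derivative; `dWirtBar (1, 0) = ∂/∂q̄₁`, `dWirtBar (0, 1) = ∂/∂q̄₂`. -/
def dWirtBar (e : C2) (f : C2 → ℂ) (q : C2) : ℂ :=
  (1 / 2 : ℂ) * (fderiv ℝ f q e + Complex.I * fderiv ℝ f q (Complex.I • e))

/-- The second derivative `∂²K/∂e ∂ē'` of a real function. -/
def levi (K : C2 → ℝ) (e e' : C2) (q : C2) : ℂ :=
  dWirt e (dWirtBar e' (fun p => (K p : ℂ))) q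

/-- `(dc ∧ dc̄')(u, v)` for complex linear coordinates `c`, `c'` on `ℂ²`. -/
def wedgeBar (c c' : C2 →L[ℂ] ℂ) (u v : C2) : ℂ :=
  c u * starRingEnd ℂ (c' v) - starRingEnd ℂ (c' u) * c v

/-- The two-form `i ∂∂̄K = i ∑ ∂²K/∂q_j∂q̄_k dq_j ∧ dq̄_k`. -/
def iddbar (K : C2 → ℝ) (q u v : C2) : ℂ :=
  let q₁ := ContinuousLinearMap.fst ℂ ℂ ℂ
  let q₂ := ContinuousLinearMap.snd ℂ ℂ ℂ
  Complex.I *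
    (levi K (1, 0) (1, 0) q * wedgeBar q₁ q₁ u v + levi K (1, 0) (0, 1) q * wedgeBar q₁ q₂ u v
      + levi K (0, 1) (1, 0) q * wedgeBar q₂ q₁ u v + levi K (0, 1) (0, 1) q * wedgeBar q₂ q₂ u v)

/-- The graph of `-i ∂K` in the Darboux chart, `(q₁, q₂) ↦ (p₁, p₂, q₁, q₂)` with
`p_j = -i ∂K/∂q_j`, as a map into the groupoid. -/
def brane (K : C2 → ℝ) (q : C2) : Gpd :=
  darbouxInv (-Complex.I * dWirt (1, 0) (fun p => (K p : ℂ)) q,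
    -Complex.I * dWirt (0, 1) (fun p => (K p : ℂ)) q, q.1, q.2)

/-- The restriction of the target map to the brane, in the coordinates `(q₁, q₂)`. -/
def piPlus (K : C2 → ℝ) (q : C2) : C2 := target (brane K q)

/-- The restriction of the source map to the brane, in the coordinates `(q₁, q₂)`. -/
def piMinus (K : C2 → ℝ) (q : C2) : C2 := source (brane K q)

/-- The pullback of `Ω` to the brane, a complex-valued real two-form on `ℝ⁴`. -/
def braneForm (K : C2 → ℝ) (q : C2) : C2 →L[ℝ] C2 →L[ℝ] ℂ :=
  ((groupoidForm (brane K q)).bilinearRestrictScalars ℝ).bilinearComp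
    (fderiv ℝ (brane K) q) (fderiv ℝ (brane K) q)

/-- `F`, the real part of the pullback of `Ω` (the imaginary part vanishes on a brane). -/
def formF (K : C2 → ℝ) (q : C2) : C2 →L[ℝ] (C2 →L[ℝ] ℝ) :=
  (ContinuousLinearMap.compL ℝ C2 ℂ ℝ Complex.reCLM).comp (braneForm K q)

/-- `f` is a diffeomorphism of `ℝ⁴`. -/
def IsDiffeo (f : C2 → C2) : Prop :=
  ContDiff ℝ ∞ f ∧ ∃ h : C2 → C2, ContDiff ℝ ∞ h ∧ Function.LeftInverse h f ∧
    Function.RightInverse h f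

/-- The graph of `-i ∂K` is a brane bisection: it is Lagrangian for `Im Ω`, and source and
target restrict to diffeomorphisms of it onto `ℂ²`. -/
structure IsBraneBisection (K : C2 → ℝ) : Prop where
  smooth : ContDiff ℝ ∞ (brane K)
  lagrangian : ∀ q u v, (braneForm K q u v).im = 0
  target_diffeo : IsDiffeo (piPlus K)
  source_diffeo : IsDiffeo (piMinus K)

/-- The standard complex structure of `ℂ²`. -/
def stdI : C2 →L[ℝ] C2 := Complex.I • ContinuousLinearMap.id ℝ C2

/-- The pullback `Df⁻¹ ∘ i ∘ Df` of the complex structure of `ℂ²` under a diffeomorphism. -/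
def pullbackI (f : C2 → C2) (q : C2) : C2 →L[ℝ] C2 :=
  (fderiv ℝ f q).inverse.comp (stdI.comp (fderiv ℝ f q))

/-- The coefficient of the holomorphic covector `dz_e` in the `(1,0)`-part of a real covector. -/
def coeff (e : C2) (ζ : C2 →L[ℝ] ℝ) : ℂ :=
  (1 / 2 : ℂ) * ((ζ e : ℂ) - Complex.I * (ζ (Complex.I • e) : ℂ))

/-- The coefficient `ζ_e` depends linearly and continuously on `ζ`. -/
def coeffL (e : C2) : (C2 →L[ℝ] ℝ) →L[ℝ] ℂ :=
  (1 / 2 : ℂ) • (Complex.ofRealCLM.comp (ContinuousLinearMap.apply ℝ ℝ e)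
    - Complex.I • Complex.ofRealCLM.comp (ContinuousLinearMap.apply ℝ ℝ (Complex.I • e)))

/-- The bivector `Π = x ∂_x ∧ ∂_y` evaluated on the `(1,0)`-parts of two real covectors. -/
def linearPoisson (z : C2) (η ζ : C2 →L[ℝ] ℝ) : ℂ :=
  z.1 * (coeff (1, 0) η * coeff (0, 1) ζ - coeff (0, 1) η * coeff (1, 0) ζ)

/-- The real Poisson structure `-4 Im Π` as a map `T* → T`, a bivector `Q` being the map
`ζ ↦ Q(·, ζ)`; this is `ζ ↦ (2 i x ζ_y, -2 i x ζ_x)`, see `apply_realPoisson`. -/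
def realPoisson (z : C2) : (C2 →L[ℝ] ℝ) →L[ℝ] C2 :=
  ((2 * Complex.I * z.1) • coeffL (0, 1)).prod (-(2 * Complex.I * z.1) • coeffL (1, 0))

theorem apply_realPoisson (z : C2) (η ζ : C2 →L[ℝ] ℝ) :
    η (realPoisson z ζ) = -4 * (linearPoisson z η ζ).im := by
  have key : ∀ v : C2, η v = 2 * (coeff (1, 0) η * v.1 + coeff (0, 1) η * v.2).re := by
    intro v
    have hv : v = v.1.re • ((1, 0) : C2) + v.1.im • (Complex.I • ((1, 0) : C2))
        + (v.2.re • ((0, 1) : C2) + v.2.im • (Complex.I • ((0, 1) : C2))) := by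
      ext <;> simp
    have h := congrArg η hv
    simp only [map_add, map_smul, smul_eq_mul] at h
    rw [h]
    simp [coeff]
    ring
  rw [key]
  simp [realPoisson, linearPoisson, coeff, coeffL]
  ring

/-- The pullback of the Poisson structure `-4 Im Π` under a diffeomorphism. -/
def pullbackPoisson (f : C2 → C2) (q : C2) : (C2 →L[ℝ] ℝ) →L[ℝ] C2 :=
  (fderiv ℝ f q).inverse.comp ((realPoisson (f q)).comp (transpose (fderiv ℝ f q).inverse))

/-- `I₊`, for which the target map of the brane is holomorphic. -/
def iPlus (K : C2 → ℝ) (q : C2) : C2 →L[ℝ] C2 := pullbackI (piPlus K) q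

/-- `I₋`, for which the source map of the brane is holomorphic. -/
def iMinus (K : C2 → ℝ) (q : C2) : C2 →L[ℝ] C2 := pullbackI (piMinus K) q

/-- `g = -½ F (I₊ + I₋)`. -/
def metricG (K : C2 → ℝ) (q : C2) : C2 →L[ℝ] (C2 →L[ℝ] ℝ) :=
  (-(1 / 2) : ℝ) • (formF K q).comp (iPlus K q + iMinus K q)

/-- `b = -½ F (I₊ - I₋)`. -/
def fieldB (K : C2 → ℝ) (q : C2) : C2 →L[ℝ] (C2 →L[ℝ] ℝ) :=
  (-(1 / 2) : ℝ) • (formF K q).comp (iPlus K q - iMinus K q)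

/-- The dilogarithm `Li₂(z) = -∫₀ᶻ log(1 - u) du/u` at a real `z ≤ 1`. -/
def dilog (z : ℝ) : ℝ := -∫ u in (0 : ℝ)..z, Real.log (1 - u) / u

/-- The potential `K = |q₁|²/C - Li₂(-|q₂|²)`. -/
def potential (C : ℝ) (q : C2) : ℝ := ‖q.1‖ ^ 2 / C - dilog (-‖q.2‖ ^ 2)

end GenKahler

end

noncomputable section

namespace GenKahler

/-! ### Generalized Kähler structures from a symplectic form and two complex structures. -/

section HermitianPair

variable {E : Type*} [NormedAddCommGroup E] [NormedSpace ℝ E]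

/-! The proof separates a general criterion from an explicit computation.

Criterion (`IsHermitianPair.isGeneralizedKahler`). Let `F` be symplectic, `I₊` and `I₋` integrable,
`F I₊ + I₋* F = 0`, and `g = -½ F (I₊ + I₋)` positive. Then `b + g = -F I₊` and `b - g = F I₋`, and
`T ⊕ T*` is the sum of the graphs `C₊`, `C₋` of these two maps. The graphs are orthogonal for the
pairing, which is `g` on `C₊` and `-g` on `C₋`. The endomorphism `J_B` acts as `I₊` on `C₊` and as
`I₋` on `C₋`, while `J_A` acts as `I₊` and `-I₋`. All algebraic axioms follow from this, and so does
`J_A = (0, -F⁻¹; F, 0)`, whose integrability is `dF = 0`. The eigenbundle of `J_B` consists of sums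
of `X - iFX` with `X` of type (1,0) for `I₊` and `Y + iFY` with `Y` of type (1,0) for `I₋`. Their
Courant brackets are found from Cartan's formula, and their types from the vanishing of the
Nijenhuis tensors.

Computation. The derivative of `-Li₂(-r)` is `log (1 + r) / r`, so in the coordinates `(q₁, q₂)` the
source is `(q₂, q₁ - i log (1 + |q₂|²))` and the target is `(exp(-i q̄₁ / C) q₂, q₁)`. These maps
are triangular with evident inverses, and `F`, `I₊`, `I₋`, `Q` and `g` are read off from their
derivatives.

Positivity and completeness both come from `le_metricG`: as `β |q₂|² < 1` and `C > 1`, the cross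
term of `g` is absorbed and `g` dominates a multiple of `|dq₁|² / C + |dq₂|² / (1 + |q₂|²)`. Hence
multiples of `q₁` and `log (1 + |q₂|²)` are 1-Lipschitz, metric balls are bounded in `ℝ⁴`, and
Cauchy sequences converge. -/

theorem block_apply (A : E →L[ℝ] E) (B : (E →L[ℝ] ℝ) →L[ℝ] E) (C : E →L[ℝ] (E →L[ℝ] ℝ))
    (D : (E →L[ℝ] ℝ) →L[ℝ] (E →L[ℝ] ℝ)) (x : E) (ξ : E →L[ℝ] ℝ) :
    block A B C D (x, ξ) = (A x + B ξ, C x + D ξ) := rfl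

theorem expB_apply (b : E →L[ℝ] (E →L[ℝ] ℝ)) (x : E) (ξ : E →L[ℝ] ℝ) :
    expB b (x, ξ) = (x, b x + ξ) := by
  simp [expB, block_apply]

theorem symplecticGC_apply (F : E → E →L[ℝ] (E →L[ℝ] ℝ)) (q : E) (x : E) (ξ : E →L[ℝ] ℝ) :
    symplecticGC F q (x, ξ) = (-(F q).inverse ξ, F q x) := by
  simp [symplecticGC, block_apply]

/-- Pullback tensors are evaluated through this lemma: the value is guessed and checked after
applying `A`, so that no derivative is inverted explicitly. -/
theorem inverse_apply_of_eq {E' : Type*} [NormedAddCommGroup E'] [NormedSpace ℝ E']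
    {A : E →L[ℝ] E'} (hA : A.IsInvertible) {x : E} {y : E'} (h : A x = y) :
    A.inverse y = x := by
  obtain ⟨e, rfl⟩ := hA
  simp [← h]

theorem apply_inverse_apply {E' : Type*} [NormedAddCommGroup E'] [NormedSpace ℝ E']
    {A : E →L[ℝ] E'} (hA : A.IsInvertible) (y : E') : A (A.inverse y) = y := by
  obtain ⟨e, rfl⟩ := hA
  simp

theorem isInvertible_of_sq_eq_neg {I : E →L[ℝ] E} (hI : ∀ v, I (I v) = -v) : I.IsInvertible :=
  ⟨ContinuousLinearEquiv.equivOfInverse I (-I) (fun v => by simp [hI]) (fun v => by simp [hI]),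
    rfl⟩

/-- A two-form `F` with two almost complex structures that are integrable and are exchanged by
`F`-transposition, up to sign. The integrability is the vanishing of the Nijenhuis tensor. -/
structure IsHermitianPair (F : E → E →L[ℝ] (E →L[ℝ] ℝ)) (Ip Im : E → E →L[ℝ] E) : Prop where
  symplectic : IsSymplecticForm F
  smooth_plus : ContDiff ℝ ∞ Ip
  smooth_minus : ContDiff ℝ ∞ Im
  sq_plus : ∀ q v, Ip q (Ip q v) = -v
  sq_minus : ∀ q v, Im q (Im q v) = -v
  nijenhuis_plus : ∀ q a c, fderiv ℝ Ip q (Ip q a) c - fderiv ℝ Ip q (Ip q c) a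
    - Ip q (fderiv ℝ Ip q a c) + Ip q (fderiv ℝ Ip q c a) = 0
  nijenhuis_minus : ∀ q a c, fderiv ℝ Im q (Im q a) c - fderiv ℝ Im q (Im q c) a
    - Im q (fderiv ℝ Im q a c) + Im q (fderiv ℝ Im q c a) = 0
  compat : ∀ q u v, F q (Ip q u) v = -F q u (Im q v)

set_option maxSynthPendingDepth 3 in
theorem IsSymplecticForm.neg {F : E → E →L[ℝ] (E →L[ℝ] ℝ)} (h : IsSymplecticForm F) :
    IsSymplecticForm (fun q => -F q) where
  smooth := h.smooth.neg
  skew q u v := by simp [h.skew q u v]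
  closed q u v w := by
    have := h.closed q u v w
    have e : fderiv ℝ (fun q => -F q) q = -fderiv ℝ F q := fderiv_neg
    rw [e]
    simp only [neg_apply]
    linarith
  nondegenerate q := by
    have : ⇑(-F q) = (fun x => -x) ∘ F q := rfl
    rw [this]
    exact neg_bijective.comp (h.nondegenerate q)

/-- This symmetry exchanges the graphs of `-F I₊` and `F I₋`, so bracket computations are only
needed with a first factor of `I₊` type. -/
theorem IsHermitianPair.swap {F : E → E →L[ℝ] (E →L[ℝ] ℝ)} {Ip Im : E → E →L[ℝ] E}
    (h : IsHermitianPair F Ip Im) : IsHermitianPair (fun q => -F q) Im Ip where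
  symplectic := h.symplectic.neg
  smooth_plus := h.smooth_minus
  smooth_minus := h.smooth_plus
  sq_plus := h.sq_minus
  sq_minus := h.sq_plus
  nijenhuis_plus := h.nijenhuis_minus
  nijenhuis_minus := h.nijenhuis_plus
  compat q u v := by
    simp only [neg_apply, neg_neg]
    rw [h.symplectic.skew q _ v, h.symplectic.skew q u, h.compat]

/-! ### Derivatives of sections -/

theorem fderiv_apply_field {G H : Type*} [NormedAddCommGroup G] [NormedSpace ℝ G]
    [NormedAddCommGroup H] [NormedSpace ℝ H]
    {I : E → G →L[ℝ] H} {X : E → G} {q : E} (hI : DifferentiableAt ℝ I q)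
    (hX : DifferentiableAt ℝ X q) (w : E) :
    fderiv ℝ (fun p => I p (X p)) q w = fderiv ℝ I q w (X q) + I q (fderiv ℝ X q w) := by
  rw [fderiv_clm_apply hI hX]
  simp [add_comm]

/-- Differentiating `I² = -1` shows that every directional derivative of `I` anticommutes with `I`.
-/
theorem fderiv_sq_eq_neg {I : E → E →L[ℝ] E} (hI : Differentiable ℝ I)
    (hsq : ∀ q v, I q (I q v) = -v) (q w v : E) :
    fderiv ℝ I q w (I q v) = -I q (fderiv ℝ I q w v) := by
  have h1 : (fun p => I p (I p v)) = fun _ => -v := funext fun p => hsq p v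
  have h2 := fderiv_apply_field (hI q) (X := fun p => I p v)
    ((hI q).clm_apply (differentiableAt_const v)) w
  rw [h1] at h2
  have h3 := fderiv_apply_field (hI q) (X := fun _ => v) (differentiableAt_const v) w
  rw [h3] at h2
  simp only [fderiv_fun_const, Pi.zero_apply, zero_apply, map_zero, add_zero] at h2
  exact eq_neg_of_add_eq_zero_left h2.symm

theorem lieDerivForm_apply (X : E → E) (η : E → (E →L[ℝ] ℝ)) (q v : E) :
    lieDerivForm X η q v = fderiv ℝ η q (X q) v + η q (fderiv ℝ X q v) := rfl

theorem contractExtDeriv_apply (Y : E → E) (ξ : E → (E →L[ℝ] ℝ)) (q v : E) :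
    contractExtDeriv Y ξ q v = fderiv ℝ ξ q (Y q) v - fderiv ℝ ξ q v (Y q) := rfl

/-- Cartan's formula `ι_B d(ι_A F) = L_A (ι_B F) - ι_[A,B] F` for a closed form `F`. -/
theorem contractExtDeriv_symplectic {F : E → E →L[ℝ] (E →L[ℝ] ℝ)} (hF : IsSymplecticForm F)
    {A B : E → E} (hA : Differentiable ℝ A) (hB : Differentiable ℝ B) (q : E) :
    contractExtDeriv B (fun p => F p (A p)) q
      = lieDerivForm A (fun p => F p (B p)) q - F q (VectorField.lieBracket ℝ A B q) := by
  have hd : Differentiable ℝ F := hF.smooth.differentiable (by simp)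
  ext v
  simp only [sub_apply, contractExtDeriv_apply, lieDerivForm_apply,
    fderiv_apply_field (hd q) (hA q), fderiv_apply_field (hd q) (hB q), VectorField.lieBracket,
    map_sub, add_apply]
  have h1 := hF.closed q (A q) (B q) v
  -- The derivative of a skew form is skew; this aligns one term of the cyclic sum in `dF = 0` with
  -- the formula for `d(ι_A F)`.
  have h2 : fderiv ℝ F q (B q) v (A q) = -fderiv ℝ F q (B q) (A q) v := by
    have e1 : (fun p => F p v (A q)) = fun p => -F p (A q) v := funext fun p => hF.skew p _ _
    have e2 : ∀ x y, fderiv ℝ (fun p => F p x y) q (B q) = fderiv ℝ F q (B q) x y := by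
      intro x y
      have d1 : DifferentiableAt ℝ (fun p => F p x) q := (hd q).clm_apply (differentiableAt_const x)
      rw [fderiv_apply_field d1 (differentiableAt_const y),
        fderiv_apply_field (hd q) (differentiableAt_const x)]
      simp
    rw [← e2, e1, fderiv_fun_neg, neg_apply, e2]
  have h3 := hF.skew q (fderiv ℝ A q v) (B q)
  linarith

/-- The fields `A'` and `B'` are unrelated to `A` and `B`, so the formula applies to the real and
imaginary parts of complex sections. Only Lie derivatives of forms are left, and these cancel or
combine in the complex brackets. -/
theorem courant_symplectic {F : E → E →L[ℝ] (E →L[ℝ] ℝ)} (hF : IsSymplecticForm F)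
    {A A' B B' : E → E} (hA' : Differentiable ℝ A') (hB : Differentiable ℝ B) (q : E) :
    courant (fun p => (A p, F p (A' p))) (fun p => (B p, F p (B' p))) q
      = (VectorField.lieBracket ℝ A B q, lieDerivForm A (fun p => F p (B' p)) q
        - lieDerivForm A' (fun p => F p (B p)) q + F q (VectorField.lieBracket ℝ A' B q)) := by
  simp only [courant, contractExtDeriv_symplectic hF hA' hB]
  ext1 <;> simp only []
  abel

/-! ### Types of vector fields and forms -/

/-- The bracket of two `(1,0)` vector fields is of type `(1,0)`. -/
theorem lieBracket_type {I : E → E →L[ℝ] E} (hI : Differentiable ℝ I)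
    (hsq : ∀ q v, I q (I q v) = -v)
    (hN : ∀ q a c, fderiv ℝ I q (I q a) c - fderiv ℝ I q (I q c) a
      - I q (fderiv ℝ I q a c) + I q (fderiv ℝ I q c a) = 0)
    {X Y : E → E} (hX : Differentiable ℝ X) (hY : Differentiable ℝ Y) (q : E) :
    VectorField.lieBracket ℝ X (fun p => -I p (Y p)) q
        + VectorField.lieBracket ℝ (fun p => -I p (X p)) Y q
      = -I q (VectorField.lieBracket ℝ X Y q
        - VectorField.lieBracket ℝ (fun p => -I p (X p)) (fun p => -I p (Y p)) q) := by
  simp only [VectorField.lieBracket, fderiv_fun_neg, neg_apply, fderiv_apply_field (hI q) (hX q),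
    fderiv_apply_field (hI q) (hY q), map_sub, map_neg, map_add, hsq]
  have h1 := hN q (X q) (Y q)
  have h2 := hN q (X q) (I q (Y q))
  simp only [fderiv_sq_eq_neg hI hsq, hsq, map_neg, neg_apply] at h2
  have h3 : I q (fderiv ℝ I q (I q (X q)) (Y q)) - I q (fderiv ℝ I q (I q (Y q)) (X q))
      = -fderiv ℝ I q (X q) (Y q) + fderiv ℝ I q (Y q) (X q) := by
    have := congrArg (I q) h1
    simp only [map_sub, map_add, hsq, map_zero] at this
    rw [← sub_eq_zero, ← this]
    abel
  rw [sub_eq_iff_eq_add] at h3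
  rw [h3]
  abel

/-- The Lie derivative of a `(0,1)` form along a `(1,0)` vector field is of type `(0,1)`. -/
theorem lieDerivForm_type {I : E → E →L[ℝ] E} (hI : Differentiable ℝ I)
    (hsq : ∀ q v, I q (I q v) = -v)
    (hN : ∀ q a c, fderiv ℝ I q (I q a) c - fderiv ℝ I q (I q c) a
      - I q (fderiv ℝ I q a c) + I q (fderiv ℝ I q c a) = 0)
    {X₁ X₂ : E → E} {σ₁ σ₂ : E → (E →L[ℝ] ℝ)} (hX : Differentiable ℝ X₁)
    (hσ : Differentiable ℝ σ₁) (hX₂ : ∀ p, X₂ p = -I p (X₁ p))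
    (hσ₂ : ∀ p, σ₂ p = (σ₁ p).comp (I p)) (q v : E) :
    (lieDerivForm X₁ σ₁ q - lieDerivForm X₂ σ₂ q) (I q v)
      = (lieDerivForm X₁ σ₂ q + lieDerivForm X₂ σ₁ q) v := by
  obtain rfl : X₂ = fun p => -I p (X₁ p) := funext hX₂
  have hσ₂' : ∀ w z, fderiv ℝ σ₂ q w z = fderiv ℝ σ₁ q w (I q z) + σ₁ q (fderiv ℝ I q w z) := by
    intro w z
    rw [funext hσ₂, fderiv_clm_comp (hσ q) (hI q)]
    simp [add_comm]
  -- The second argument is `I v` because the form on the left of the goal is tested on `I v`;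
  -- pairing the identity with `σ₁` then gives the terms containing derivatives of `I`.
  have h1 := hN q (X₁ q) (I q v)
  simp only [fderiv_sq_eq_neg hI hsq, hsq, map_neg, neg_apply] at h1
  have h2 := congrArg (σ₁ q) h1
  simp only [sub_apply, add_apply, lieDerivForm_apply, hσ₂', hσ₂, ContinuousLinearMap.comp_apply,
    fderiv_fun_neg, neg_apply, fderiv_apply_field (hI q) (hX q), map_add, map_neg, map_sub, hsq,
    map_zero, fderiv_sq_eq_neg hI hsq] at h2 ⊢
  linarith

/-- The contraction of the differential of a `(0,1)` form with a `(1,0)` vector field is of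
type `(0,1)`. -/
theorem contractExtDeriv_type {I : E → E →L[ℝ] E} (hI : Differentiable ℝ I)
    (hsq : ∀ q v, I q (I q v) = -v)
    (hN : ∀ q a c, fderiv ℝ I q (I q a) c - fderiv ℝ I q (I q c) a
      - I q (fderiv ℝ I q a c) + I q (fderiv ℝ I q c a) = 0)
    {X₁ X₂ : E → E} {σ₁ σ₂ : E → (E →L[ℝ] ℝ)}
    (hσ : Differentiable ℝ σ₁) (hX₂ : ∀ p, X₂ p = -I p (X₁ p))
    (hσ₂ : ∀ p, σ₂ p = (σ₁ p).comp (I p)) (q v : E) :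
    (contractExtDeriv X₁ σ₁ q - contractExtDeriv X₂ σ₂ q) (I q v)
      = (contractExtDeriv X₁ σ₂ q + contractExtDeriv X₂ σ₁ q) v := by
  have hσ₂' : ∀ w z, fderiv ℝ σ₂ q w z = fderiv ℝ σ₁ q w (I q z) + σ₁ q (fderiv ℝ I q w z) := by
    intro w z
    rw [funext hσ₂, fderiv_clm_comp (hσ q) (hI q)]
    simp [add_comm]
  have h1 := hN q (X₁ q) (I q v)
  simp only [fderiv_sq_eq_neg hI hsq, hsq, map_neg, neg_apply] at h1
  have h2 := congrArg (σ₁ q) h1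
  simp only [sub_apply, add_apply, contractExtDeriv_apply, hσ₂', hX₂, map_add, map_neg, map_sub, hsq,
    map_zero, fderiv_sq_eq_neg hI hsq, neg_apply] at h2 ⊢
  linarith

theorem IsSymplecticForm.isInvertible [FiniteDimensional ℝ E] {F : E → E →L[ℝ] (E →L[ℝ] ℝ)}
    (hF : IsSymplecticForm F) (q : E) : (F q).IsInvertible := by
  refine ⟨(LinearEquiv.ofBijective (F q).toLinearMap (hF.nondegenerate q)).toContinuousLinearEquiv,
    ?_⟩
  ext x
  rfl

theorem contDiff_inverse [CompleteSpace E] {E' : Type*} [NormedAddCommGroup E'] [NormedSpace ℝ E']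
    {A : E → E →L[ℝ] E'} (hA : ContDiff ℝ ∞ A) (hi : ∀ q, (A q).IsInvertible) :
    ContDiff ℝ ∞ fun q => (A q).inverse := by
  rw [contDiff_iff_contDiffAt]
  intro q
  obtain ⟨e, he⟩ := hi q
  have h := contDiffAt_map_inverse (𝕜 := ℝ) (n := ∞) e
  rw [he] at h
  exact h.comp q hA.contDiffAt

theorem lieDerivForm_neg_field (X : E → E) (η : E → (E →L[ℝ] ℝ)) (q : E) :
    lieDerivForm (fun p => -X p) η q = -lieDerivForm X η q := by
  ext v
  simp only [lieDerivForm_apply, neg_apply, fderiv_fun_neg, map_neg]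
  ring

theorem lieDerivForm_neg_form (X : E → E) (η : E → (E →L[ℝ] ℝ)) (q : E) :
    lieDerivForm X (fun p => -η p) q = -lieDerivForm X η q := by
  ext v
  simp only [lieDerivForm_apply, neg_apply, fderiv_fun_neg]
  ring

theorem lieBracket_fun_neg_left (X Y : E → E) (q : E) :
    VectorField.lieBracket ℝ (fun p => -X p) Y q = -VectorField.lieBracket ℝ X Y q := by
  simp only [VectorField.lieBracket, fderiv_fun_neg, neg_apply, map_neg]
  abel

/-! ### Involutivity of the eigenbundles. -/

/-- The bracket of the sections `X - i F X` and `Y - i F Y` for `(1,0)` fields `X`, `Y`. -/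
theorem IsHermitianPair.courant_plus_plus {F : E → E →L[ℝ] (E →L[ℝ] ℝ)} {Ip Im : E → E →L[ℝ] E}
    (h : IsHermitianPair F Ip Im) {X₁ X₂ Y₁ Y₂ : E → E}
    (hX₁ : Differentiable ℝ X₁) (hX₂ : Differentiable ℝ X₂)
    (hY₁ : Differentiable ℝ Y₁) (hY₂ : Differentiable ℝ Y₂)
    (hX : ∀ p, X₂ p = -Ip p (X₁ p)) (hY : ∀ p, Y₂ p = -Ip p (Y₁ p)) (q : E) :
    ∃ P : E,
      courant (fun p => (X₁ p, F p (X₂ p))) (fun p => (Y₁ p, F p (Y₂ p))) q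
        - courant (fun p => (X₂ p, F p (-X₁ p))) (fun p => (Y₂ p, F p (-Y₁ p))) q
        = (P, -F q (Ip q P)) ∧
      courant (fun p => (X₁ p, F p (X₂ p))) (fun p => (Y₂ p, F p (-Y₁ p))) q
        + courant (fun p => (X₂ p, F p (-X₁ p))) (fun p => (Y₁ p, F p (Y₂ p))) q
        = (-Ip q P, -F q P) := by
  have hI := h.smooth_plus.differentiable (by simp)
  have hF := h.symplectic
  have hZ := lieBracket_type hI h.sq_plus h.nijenhuis_plus hX₁ hY₁ q
  rw [← funext hX, ← funext hY] at hZ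
  -- In complex notation `L_X(FY) - ι_Y d(FX) = F[X, Y]`, so the bracket is `[X, Y] - iF[X, Y]`, and
  -- `P` is the real part of `[X, Y]`.
  refine ⟨VectorField.lieBracket ℝ X₁ Y₁ q - VectorField.lieBracket ℝ X₂ Y₂ q, ?_, ?_⟩
  · rw [courant_symplectic hF hX₂ hY₁, courant_symplectic hF hX₁.fun_neg hY₂, ← map_neg, ← hZ]
    simp only [lieDerivForm_neg_form, lieDerivForm_neg_field, lieBracket_fun_neg_left, map_neg,
      map_add, Prod.mk_sub_mk, Prod.mk.injEq, true_and]
    abel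
  · rw [courant_symplectic hF hX₂ hY₂, courant_symplectic hF hX₁.fun_neg hY₁, ← hZ]
    simp only [lieDerivForm_neg_form, lieDerivForm_neg_field, lieBracket_fun_neg_left, map_neg,
      map_sub, Prod.mk_add_mk, Prod.mk.injEq, true_and]
    abel

/-- The bracket of the sections `X - i F X` and `Y + i F Y` for a `(1,0)` field `X` of `I₊` and
a `(1,0)` field `Y` of `I₋`. -/
theorem IsHermitianPair.courant_plus_minus [FiniteDimensional ℝ E]
    {F : E → E →L[ℝ] (E →L[ℝ] ℝ)} {Ip Im : E → E →L[ℝ] E}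
    (h : IsHermitianPair F Ip Im) {X₁ X₂ Y₁ Y₂ : E → E}
    (hX₁ : Differentiable ℝ X₁) (hX₂ : Differentiable ℝ X₂)
    (hY₁ : Differentiable ℝ Y₁) (hY₂ : Differentiable ℝ Y₂)
    (hX : ∀ p, X₂ p = -Ip p (X₁ p)) (hY : ∀ p, Y₂ p = -Im p (Y₁ p)) (q : E) :
    ∃ P M : E,
      courant (fun p => (X₁ p, F p (X₂ p))) (fun p => (Y₁ p, F p (-Y₂ p))) q
        - courant (fun p => (X₂ p, F p (-X₁ p))) (fun p => (Y₂ p, F p (Y₁ p))) q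
        = (P, -F q (Ip q P)) + (M, F q (Im q M)) ∧
      courant (fun p => (X₁ p, F p (X₂ p))) (fun p => (Y₂ p, F p (Y₁ p))) q
        + courant (fun p => (X₂ p, F p (-X₁ p))) (fun p => (Y₁ p, F p (-Y₂ p))) q
        = (-Ip q P, -F q P) + (-Im q M, F q M) := by
  have hIp := h.smooth_plus.differentiable (by simp)
  have hIm := h.smooth_minus.differentiable (by simp)
  have hF := h.symplectic
  have hFd : Differentiable ℝ F := hF.smooth.differentiable (by simp)
  have hc : ∀ p u v, F p (Im p u) v = -F p u (Ip p v) := by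
    intro p u v
    rw [hF.skew p _ v, hF.skew p u, h.compat, neg_neg]
  have hinv : ∀ ζ, F q ((F q).inverse ζ) = ζ := apply_inverse_apply (hF.isInvertible q)
  have hinj := (hF.nondegenerate q).1
  -- By compatibility `FY` is of type (0,1) for `I₊` and `FX` is of type (0,1) for `I₋`; these are
  -- the types required by the two lemmas.
  have hL := fun v => lieDerivForm_type hIp h.sq_plus h.nijenhuis_plus
    (σ₁ := fun p => F p (Y₁ p)) (σ₂ := fun p => F p (Y₂ p)) hX₁ (hFd.clm_apply hY₁) hX
    (fun p => by ext v; simp [hY, hc]) q v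
  have hC := fun v => contractExtDeriv_type hIm h.sq_minus h.nijenhuis_minus
    (σ₁ := fun p => F p (X₁ p)) (σ₂ := fun p => F p (X₂ p)) (hFd.clm_apply hX₁) hY
    (fun p => by ext v; simp [hX, h.compat]) q v
  simp only [contractExtDeriv_symplectic hF hX₁ hY₁, contractExtDeriv_symplectic hF hX₁ hY₂,
    contractExtDeriv_symplectic hF hX₂ hY₁, contractExtDeriv_symplectic hF hX₂ hY₂] at hC
  -- Put `M = F⁻¹ L_X(FY)`, with real part `M₁` and imaginary part `M₂`, and `P = [X, Y] - M`.
  -- Cartan's formula gives `L_X(FY) + ι_Y d(FX) = FM - FP`, so the bracket is `(P - iFP) + (M +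
  -- iFM)`. It remains to find the types of `M` and `P`.
  set M₁ := (F q).inverse (lieDerivForm X₁ (fun p => F p (Y₁ p)) q
    - lieDerivForm X₂ (fun p => F p (Y₂ p)) q) with hM₁
  set M₂ := (F q).inverse (lieDerivForm X₁ (fun p => F p (Y₂ p)) q
    + lieDerivForm X₂ (fun p => F p (Y₁ p)) q) with hM₂
  have hM : Im q M₁ = -M₂ := by
    apply hinj
    ext v
    rw [hc, hM₁, hM₂, hinv, map_neg, neg_apply, hinv, hL]
  set Z₁ := VectorField.lieBracket ℝ X₁ Y₁ q - VectorField.lieBracket ℝ X₂ Y₂ q with hZ₁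
  set Z₂ := VectorField.lieBracket ℝ X₁ Y₂ q + VectorField.lieBracket ℝ X₂ Y₁ q with hZ₂
  -- Here `FP = -ι_Y d(FX)` is of type (0,1) for `I₋`, hence `P` is of type (1,0) for `I₊`.
  have hP : Ip q (Z₁ - M₁) = -(Z₂ - M₂) := by
    apply hinj
    ext v
    have := hC v
    rw [h.compat]
    simp only [map_sub, map_add, map_neg, sub_apply, add_apply, neg_apply, hZ₁, hZ₂, hM₁, hM₂,
      hinv] at this ⊢
    linarith
  refine ⟨Z₁ - M₁, M₁, ?_, ?_⟩
  · rw [courant_symplectic hF hX₂ hY₁, courant_symplectic hF hX₁.fun_neg hY₂, hM, hP]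
    simp only [lieDerivForm_neg_form, lieDerivForm_neg_field, lieBracket_fun_neg_left, map_neg,
      map_add, map_sub, Prod.mk_sub_mk, Prod.mk_add_mk, Prod.mk.injEq, neg_neg, hM₂, hinv, hZ₂]
    exact ⟨by rw [hZ₁]; abel, by abel⟩
  · rw [courant_symplectic hF hX₂ hY₂, courant_symplectic hF hX₁.fun_neg hY₁, hM, hP]
    simp only [lieDerivForm_neg_form, lieDerivForm_neg_field, lieBracket_fun_neg_left, map_neg,
      map_sub, Prod.mk_add_mk, Prod.mk.injEq, neg_neg, hM₁, hinv, hZ₁]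
    exact ⟨by rw [hZ₂]; abel, by abel⟩

theorem courant_add_left {u u' v : E → GTangent E} (hu : Differentiable ℝ u)
    (hu' : Differentiable ℝ u') (q : E) :
    courant (fun p => u p + u' p) v q = courant u v q + courant u' v q := by
  have a1 := (hu.fst) q
  have a2 := (hu'.fst) q
  have b1 := (hu.snd) q
  have b2 := (hu'.snd) q
  ext1
  · simp only [courant, VectorField.lieBracket, Prod.fst_add, fderiv_fun_add a1 a2, map_add,
      add_apply]
    abel
  · ext x
    simp only [courant, Prod.fst_add, Prod.snd_add, sub_apply, add_apply, lieDerivForm_apply,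
      contractExtDeriv_apply, fderiv_fun_add a1 a2, fderiv_fun_add b1 b2, map_add]
    abel

theorem courant_add_right {u v v' : E → GTangent E} (hv : Differentiable ℝ v)
    (hv' : Differentiable ℝ v') (q : E) :
    courant u (fun p => v p + v' p) q = courant u v q + courant u v' q := by
  have a1 := (hv.fst) q
  have a2 := (hv'.fst) q
  have b1 := (hv.snd) q
  have b2 := (hv'.snd) q
  ext1
  · simp only [courant, VectorField.lieBracket, Prod.fst_add, fderiv_fun_add a1 a2, map_add,
      add_apply]
    abel
  · ext x
    simp only [courant, Prod.fst_add, Prod.snd_add, sub_apply, add_apply, lieDerivForm_apply,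
      contractExtDeriv_apply, fderiv_fun_add b1 b2, map_add]
    abel

/-- The sections of the `+i`-eigenbundle of the graph type endomorphism `(0, -F⁻¹; F, 0)` are
closed under the Courant bracket. -/
theorem IsSymplecticForm.involutive [FiniteDimensional ℝ E] {F : E → E →L[ℝ] (E →L[ℝ] ℝ)}
    (hF : IsSymplecticForm F) (u₁ u₂ v₁ v₂ : E → GTangent E)
    (hu₁ : ContDiff ℝ ∞ u₁) (hu₂ : ContDiff ℝ ∞ u₂) (hv₁ : ContDiff ℝ ∞ v₁)
    (hv₂ : ContDiff ℝ ∞ v₂) (hu : InEigenbundle (symplecticGC F) u₁ u₂)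
    (hv : InEigenbundle (symplecticGC F) v₁ v₂) :
    InEigenbundle (symplecticGC F) (fun q => courant u₁ v₁ q - courant u₂ v₂ q)
      (fun q => courant u₁ v₂ q + courant u₂ v₁ q) := by
  have hinv : ∀ q x, (F q).inverse (F q x) = x :=
    fun q x => inverse_apply_of_eq (hF.isInvertible q) rfl
  -- The eigenbundle of `(0, -F⁻¹; F, 0)` is the graph of `-iF` over all complex vectors, with no
  -- condition on their type.
  have form : ∀ {w₁ w₂ : E → GTangent E}, InEigenbundle (symplecticGC F) w₁ w₂ →
      w₁ = (fun p => ((w₁ p).1, F p (w₂ p).1)) ∧ w₂ = fun p => ((w₂ p).1, F p (-(w₁ p).1)) := by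
    intro w₁ w₂ hw
    constructor
    · funext p
      have := congrArg Prod.snd (hw p).2
      rw [← Prod.mk.eta (p := w₂ p), symplecticGC_apply] at this
      exact Prod.ext rfl this.symm
    · funext p
      have := congrArg Prod.snd (hw p).1
      rw [← Prod.mk.eta (p := w₁ p), symplecticGC_apply] at this
      simp only [Prod.snd_neg] at this
      exact Prod.ext rfl (by rw [map_neg, this, neg_neg])
  obtain ⟨eu₁, eu₂⟩ := form hu
  obtain ⟨ev₁, ev₂⟩ := form hv
  have du₁ := (hu₁.differentiable (by simp)).fst
  have du₂ := (hu₂.differentiable (by simp)).fst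
  have dv₁ := (hv₁.differentiable (by simp)).fst
  have dv₂ := (hv₂.differentiable (by simp)).fst
  set X₁ := fun p => (u₁ p).1
  set X₂ := fun p => (u₂ p).1
  set Y₁ := fun p => (v₁ p).1
  set Y₂ := fun p => (v₂ p).1
  intro q
  set Z₁ := VectorField.lieBracket ℝ X₁ Y₁ q - VectorField.lieBracket ℝ X₂ Y₂ q with hZ₁
  set Z₂ := VectorField.lieBracket ℝ X₁ Y₂ q + VectorField.lieBracket ℝ X₂ Y₁ q with hZ₂
  have h₁ : courant u₁ v₁ q - courant u₂ v₂ q = (Z₁, F q Z₂) := by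
    rw [eu₁, ev₁, eu₂, ev₂, courant_symplectic hF du₂ dv₁,
      courant_symplectic hF du₁.fun_neg dv₂]
    simp only [lieDerivForm_neg_form, lieDerivForm_neg_field, lieBracket_fun_neg_left, map_neg,
      map_add, Prod.mk_sub_mk, hZ₁, hZ₂]
    ext1
    · rfl
    · simp only []
      abel
  have h₂ : courant u₁ v₂ q + courant u₂ v₁ q = (Z₂, -F q Z₁) := by
    rw [eu₁, ev₁, eu₂, ev₂, courant_symplectic hF du₂ dv₂,
      courant_symplectic hF du₁.fun_neg dv₁]
    simp only [lieDerivForm_neg_form, lieDerivForm_neg_field, lieBracket_fun_neg_left, map_neg,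
      map_sub, Prod.mk_add_mk, hZ₁, hZ₂]
    ext1
    · rfl
    · simp only []
      abel
  simp only [h₁, h₂, symplecticGC_apply, hinv, map_neg, neg_neg, Prod.neg_mk, and_self]

/-- An endomorphism that acts as `I₊` on the graph of `-F I₊` and as `I₋` on the graph of `F I₋`
has an involutive `+i`-eigenbundle. -/
theorem IsHermitianPair.involutive [FiniteDimensional ℝ E]
    {F : E → E →L[ℝ] (E →L[ℝ] ℝ)} {Ip Im : E → E →L[ℝ] E} (h : IsHermitianPair F Ip Im)
    {J : E → GTangent E →L[ℝ] GTangent E}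
    (hJp : ∀ q x, J q (x, -F q (Ip q x)) = (Ip q x, F q x))
    (hJm : ∀ q x, J q (x, F q (Im q x)) = (Im q x, -F q x))
    (hdec : ∀ q v, ∃ a b, v = (a, -F q (Ip q a)) + (b, F q (Im q b)))
    (u₁ u₂ v₁ v₂ : E → GTangent E)
    (hu₁ : ContDiff ℝ ∞ u₁) (hu₂ : ContDiff ℝ ∞ u₂) (hv₁ : ContDiff ℝ ∞ v₁)
    (hv₂ : ContDiff ℝ ∞ v₂) (hu : InEigenbundle J u₁ u₂) (hv : InEigenbundle J v₁ v₂) :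
    InEigenbundle J (fun q => courant u₁ v₁ q - courant u₂ v₂ q)
      (fun q => courant u₁ v₂ q + courant u₂ v₁ q) := by
  have hF := h.symplectic
  have hFd : Differentiable ℝ F := hF.smooth.differentiable (by simp)
  have hFi := contDiff_inverse hF.smooth hF.isInvertible
  have hinv : ∀ q x, (F q).inverse (F q x) = x :=
    fun q x => inverse_apply_of_eq (hF.isInvertible q) rfl
  -- the two components of a section of the eigenbundle
  have split : ∀ {w₁ w₂ : E → GTangent E}, ContDiff ℝ ∞ w₁ → ContDiff ℝ ∞ w₂ →
      InEigenbundle J w₁ w₂ → ∃ X₁ X₂ Y₁ Y₂ : E → E,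
        Differentiable ℝ X₁ ∧ Differentiable ℝ X₂ ∧ Differentiable ℝ Y₁ ∧ Differentiable ℝ Y₂ ∧
        (∀ p, X₂ p = -Ip p (X₁ p)) ∧ (∀ p, Y₂ p = -Im p (Y₁ p)) ∧
        (w₁ = fun p => (X₁ p, F p (X₂ p)) + (Y₁ p, F p (-Y₂ p))) ∧
        (w₂ = fun p => (X₂ p, F p (-X₁ p)) + (Y₂ p, F p (Y₁ p))) := by
    intro w₁ w₂ hw₁ hw₂ hw
    have key : ∀ p, ∃ a b, w₁ p = (a, -F p (Ip p a)) + (b, F p (Im p b)) ∧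
        w₂ p = -(Ip p a, F p a) + -(Im p b, -F p b) := by
      intro p
      obtain ⟨a, b, hab⟩ := hdec p (w₁ p)
      refine ⟨a, b, hab, ?_⟩
      have := (hw p).1
      rw [hab, map_add, hJp, hJm] at this
      rw [← neg_neg (w₂ p), ← this, neg_add]
    choose a b hab hab' using key
    -- The pointwise choices `a`, `b` satisfy `w₁.1 = a + b` and `w₂.2 = F(b - a)`; solving these
    -- equations shows that they depend smoothly on the point.
    have ha : a = fun p => (1 / 2 : ℝ) • ((w₁ p).1 - (F p).inverse (w₂ p).2) := by
      funext p
      rw [hab, hab']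
      simp only [Prod.fst_add, Prod.snd_add, Prod.neg_mk, map_add, map_neg, hinv]
      module
    have hb : b = fun p => (1 / 2 : ℝ) • ((w₁ p).1 + (F p).inverse (w₂ p).2) := by
      funext p
      rw [hab, hab']
      simp only [Prod.fst_add, Prod.snd_add, Prod.neg_mk, map_add, map_neg, hinv]
      module
    have hi2 := hFi.clm_apply hw₂.snd
    have da : ContDiff ℝ ∞ a := by rw [ha]; exact contDiff_const.smul (hw₁.fst.sub hi2)
    have db : ContDiff ℝ ∞ b := by rw [hb]; exact contDiff_const.smul (hw₁.fst.add hi2)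
    refine ⟨a, fun p => -Ip p (a p), b, fun p => -Im p (b p), da.differentiable (by simp),
      (h.smooth_plus.clm_apply da).neg.differentiable (by simp), db.differentiable (by simp),
      (h.smooth_minus.clm_apply db).neg.differentiable (by simp), fun _ => rfl, fun _ => rfl,
      ?_, ?_⟩
    · funext p
      rw [hab]
      simp
    · funext p
      rw [hab']
      simp
  obtain ⟨X₁, X₂, Y₁, Y₂, dX₁, dX₂, dY₁, dY₂, hX, hY, rfl, rfl⟩ := split hu₁ hu₂ hu
  obtain ⟨X₁', X₂', Y₁', Y₂', dX₁', dX₂', dY₁', dY₂', hX', hY', rfl, rfl⟩ := split hv₁ hv₂ hv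
  have dsec : ∀ {A B : E → E}, Differentiable ℝ A → Differentiable ℝ B →
      Differentiable ℝ (fun p => ((A p, F p (B p)) : GTangent E)) :=
    fun hA hB => hA.prodMk (hFd.clm_apply hB)
  intro q
  have pp := h.courant_plus_plus dX₁ dX₂ dX₁' dX₂' hX hX' q
  -- The remaining two brackets are those of `h.swap`: with `-F` in place of `F`, a section `Y +
  -- iFY` takes the form `Y - i(-F)Y`.
  have pm := h.courant_plus_minus dX₁ dX₂ dY₁' dY₂' hX hY' q
  have mm := h.swap.courant_plus_plus dY₁ dY₂ dY₁' dY₂' hY hY' q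
  have mp := h.swap.courant_plus_minus dY₁ dY₂ dX₁' dX₂' hY hX' q
  simp only [neg_apply, map_neg, neg_neg] at pp pm mm mp
  obtain ⟨P, hP, hP'⟩ := pp
  obtain ⟨P₂, M₂, hM₂, hM₂'⟩ := pm
  obtain ⟨M, hM, hM'⟩ := mm
  obtain ⟨M₃, P₃, hM₃, hM₃'⟩ := mp
  have dX₁n := dsec dX₁ dX₂
  have dX₂n := dsec dX₂ dX₁.fun_neg
  have dY₁n := dsec dY₁ dY₂.fun_neg
  have dY₂n := dsec dY₂ dY₁
  have dX₁n' := dsec dX₁' dX₂'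
  have dX₂n' := dsec dX₂' dX₁'.fun_neg
  have dY₁n' := dsec dY₁' dY₂'.fun_neg
  have dY₂n' := dsec dY₂' dY₁'
  simp only [courant_add_left dX₁n dY₁n, courant_add_left dX₂n dY₂n,
    courant_add_right dX₁n' dY₁n', courant_add_right dX₂n' dY₂n']
  simp only [map_neg]
  have e₁ : ∀ a b c d a' b' c' d' : GTangent E,
      (a + b + (c + d)) - (a' + b' + (c' + d')) = (a - a') + (b - b') + ((c - c') + (d - d')) :=
    fun _ _ _ _ _ _ _ _ => by abel
  have e₂ : ∀ a b c d a' b' c' d' : GTangent E,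
      (a + b + (c + d)) + (a' + b' + (c' + d')) = (a + a') + (b + b') + ((c + c') + (d + d')) :=
    fun _ _ _ _ _ _ _ _ => by abel
  have hJp' : ∀ x, J q (-Ip q x, -F q x) = (x, -F q (Ip q x)) := by
    intro x
    have := hJp q (-Ip q x)
    simpa [h.sq_plus] using this
  have hJm' : ∀ x, J q (-Im q x, F q x) = (x, F q (Im q x)) := by
    intro x
    have := hJm q (-Im q x)
    simpa [h.sq_minus] using this
  constructor
  · rw [e₁, e₂, hP, hM₂, hP', hM₂', hM, hM', hM₃, hM₃']
    simp only [map_add, hJp, hJm]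
    simp only [neg_add, Prod.neg_mk, neg_neg]
  · rw [e₁, e₂, hP, hM₂, hP', hM₂', hM, hM', hM₃, hM₃']
    simp only [map_add, hJp', hJm']

/-! ### Action of the block endomorphisms on the graphs of `b ± g`. -/

section Gualtieri

variable {g b : E → E →L[ℝ] (E →L[ℝ] ℝ)} {Ip Im : E → E →L[ℝ] E} {q : E}

theorem inverse_comp_complex (hg : (g q).IsInvertible) {I : E →L[ℝ] E} (hI : ∀ v, I (I v) = -v)
    (x : E) : ((g q).comp I).inverse (g q x) = -I x :=
  inverse_apply_of_eq (hg.comp (isInvertible_of_sq_eq_neg hI)) (by simp [hI])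

/-- Conjugation by `e^b` reduces to the graph of `g`. There `ω_±⁻¹ g = -I_±` and `I_±* g = -g I_±`,
so the `I₋` terms cancel and the `I₊` terms double. The three companion lemmas differ only in signs.
-/
theorem gualtieriB_plus (hg : (g q).IsInvertible) (hp : ∀ v, Ip q (Ip q v) = -v)
    (hm : ∀ v, Im q (Im q v) = -v) (hgp : ∀ u v, g q (Ip q u) v = -g q u (Ip q v))
    (hgm : ∀ u v, g q (Im q u) v = -g q u (Im q v)) (x : E) :
    gualtieriB g b Ip Im q (x, b q x + g q x) = (Ip q x, b q (Ip q x) + g q (Ip q x)) := by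
  have tp : transpose (Ip q) (g q x) = -g q (Ip q x) := by ext v; simp [transpose, hgp]
  have tm : transpose (Im q) (g q x) = -g q (Im q x) := by ext v; simp [transpose, hgm]
  simp only [gualtieriB, smul_apply, ContinuousLinearMap.comp_apply, expB_apply, block_apply,
    neg_apply, neg_add_cancel_left, sub_apply, add_apply, inverse_comp_complex hg hp,
    inverse_comp_complex hg hm, tp, tm]
  ext1
  · simp only [Prod.smul_mk]
    module
  · simp only [Prod.smul_mk, map_add, map_neg, map_sub]
    module

theorem gualtieriB_minus (hg : (g q).IsInvertible) (hp : ∀ v, Ip q (Ip q v) = -v)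
    (hm : ∀ v, Im q (Im q v) = -v) (hgp : ∀ u v, g q (Ip q u) v = -g q u (Ip q v))
    (hgm : ∀ u v, g q (Im q u) v = -g q u (Im q v)) (x : E) :
    gualtieriB g b Ip Im q (x, b q x - g q x) = (Im q x, b q (Im q x) - g q (Im q x)) := by
  have tp : transpose (Ip q) (g q x) = -g q (Ip q x) := by ext v; simp [transpose, hgp]
  have tm : transpose (Im q) (g q x) = -g q (Im q x) := by ext v; simp [transpose, hgm]
  simp only [gualtieriB, smul_apply, ContinuousLinearMap.comp_apply, expB_apply, block_apply,
    neg_apply, neg_add_cancel_left, sub_apply, add_apply, inverse_comp_complex hg hp,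
    inverse_comp_complex hg hm, tp, tm, sub_eq_add_neg (b q x), map_neg]
  ext1
  · simp only [Prod.smul_mk]
    module
  · simp only [Prod.smul_mk, map_add, map_neg, map_sub]
    module

theorem gualtieriA_plus (hg : (g q).IsInvertible) (hp : ∀ v, Ip q (Ip q v) = -v)
    (hm : ∀ v, Im q (Im q v) = -v) (hgp : ∀ u v, g q (Ip q u) v = -g q u (Ip q v))
    (hgm : ∀ u v, g q (Im q u) v = -g q u (Im q v)) (x : E) :
    gualtieriA g b Ip Im q (x, b q x + g q x) = (Ip q x, b q (Ip q x) + g q (Ip q x)) := by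
  have tp : transpose (Ip q) (g q x) = -g q (Ip q x) := by ext v; simp [transpose, hgp]
  have tm : transpose (Im q) (g q x) = -g q (Im q x) := by ext v; simp [transpose, hgm]
  simp only [gualtieriA, smul_apply, ContinuousLinearMap.comp_apply, expB_apply, block_apply,
    neg_apply, neg_add_cancel_left, sub_apply, add_apply, inverse_comp_complex hg hp,
    inverse_comp_complex hg hm, tp, tm]
  ext1
  · simp only [Prod.smul_mk]
    module
  · simp only [Prod.smul_mk, map_add, map_neg, map_sub]
    module

theorem gualtieriA_minus (hg : (g q).IsInvertible) (hp : ∀ v, Ip q (Ip q v) = -v)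
    (hm : ∀ v, Im q (Im q v) = -v) (hgp : ∀ u v, g q (Ip q u) v = -g q u (Ip q v))
    (hgm : ∀ u v, g q (Im q u) v = -g q u (Im q v)) (x : E) :
    gualtieriA g b Ip Im q (x, b q x - g q x) = -(Im q x, b q (Im q x) - g q (Im q x)) := by
  have tp : transpose (Ip q) (g q x) = -g q (Ip q x) := by ext v; simp [transpose, hgp]
  have tm : transpose (Im q) (g q x) = -g q (Im q x) := by ext v; simp [transpose, hgm]
  simp only [gualtieriA, smul_apply, ContinuousLinearMap.comp_apply, expB_apply, block_apply,
    neg_apply, neg_add_cancel_left, sub_apply, add_apply, inverse_comp_complex hg hp,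
    inverse_comp_complex hg hm, tp, tm, sub_eq_add_neg (b q x), map_neg]
  ext1
  · simp only [Prod.smul_mk, Prod.fst_neg]
    module
  · simp only [Prod.smul_mk, map_add, map_neg, map_sub, Prod.snd_neg]
    module

theorem contDiff_gualtieriB [FiniteDimensional ℝ E] (hg : ∀ p, (g p).IsInvertible)
    (hp : ∀ p v, Ip p (Ip p v) = -v) (hm : ∀ p v, Im p (Im p v) = -v)
    (sg : ContDiff ℝ ∞ g) (sb : ContDiff ℝ ∞ b) (sp : ContDiff ℝ ∞ Ip) (sm : ContDiff ℝ ∞ Im) :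
    ContDiff ℝ ∞ (gualtieriB g b Ip Im) := by
  rw [contDiff_clm_apply_iff]
  rintro ⟨x, ξ⟩
  have ip : ContDiff ℝ ∞ fun p => ((g p).comp (Ip p)).inverse :=
    contDiff_inverse (sg.clm_comp sp) fun p => (hg p).comp (isInvertible_of_sq_eq_neg (hp p))
  have im : ContDiff ℝ ∞ fun p => ((g p).comp (Im p)).inverse :=
    contDiff_inverse (sg.clm_comp sm) fun p => (hg p).comp (isInvertible_of_sq_eq_neg (hm p))
  have tr : ∀ {I : E → E →L[ℝ] E}, ContDiff ℝ ∞ I → ContDiff ℝ ∞ fun p => transpose (I p) :=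
    fun hI => (ContinuousLinearMap.contDiff _).comp hI
  have tp := tr sp
  have tm := tr sm
  simp only [gualtieriB, smul_apply, ContinuousLinearMap.comp_apply, expB_apply, block_apply,
    neg_apply, sub_apply, add_apply]
  fun_prop

end Gualtieri

theorem isInvertible_of_pos [FiniteDimensional ℝ E] {g : E →L[ℝ] (E →L[ℝ] ℝ)}
    (hg : ∀ u, u ≠ 0 → 0 < g u u) : g.IsInvertible := by
  have hinj : Function.Injective g := by
    rw [injective_iff_map_eq_zero]
    intro u hu
    by_contra h
    have := hg u h
    simp [hu] at this
  have hd : Module.finrank ℝ E = Module.finrank ℝ (E →L[ℝ] ℝ) := by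
    rw [← (LinearMap.toContinuousLinearMap (𝕜 := ℝ) (E := E) (F' := ℝ)).finrank_eq]
    exact Subspace.dual_finrank_eq.symm
  refine ⟨(LinearMap.linearEquivOfInjective g.toLinearMap hinj hd).toContinuousLinearEquiv, ?_⟩
  ext x
  rfl

/-- A symplectic form and a compatible pair of integrable almost complex structures define
a generalized Kähler structure of symplectic type. -/
theorem IsHermitianPair.isGeneralizedKahler [FiniteDimensional ℝ E]
    {F : E → E →L[ℝ] (E →L[ℝ] ℝ)} {Ip Im : E → E →L[ℝ] E} (h : IsHermitianPair F Ip Im)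
    {g b : E → E →L[ℝ] (E →L[ℝ] ℝ)}
    (hg : ∀ q, g q = (-(1 / 2) : ℝ) • (F q).comp (Ip q + Im q))
    (hb : ∀ q, b q = (-(1 / 2) : ℝ) • (F q).comp (Ip q - Im q))
    (hpos : ∀ q u, u ≠ 0 → 0 < g q u u) :
    IsRiemannianMetric g ∧ IsGeneralizedKahler (gualtieriA g b Ip Im) (gualtieriB g b Ip Im) ∧
      gualtieriA g b Ip Im = symplecticGC F := by
  have hF := h.symplectic
  have hFi := hF.isInvertible
  have hc : ∀ q u v, F q (Im q u) v = -F q u (Ip q v) := by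
    intro q u v
    rw [hF.skew q _ v, hF.skew q u, h.compat, neg_neg]
  have sg : ContDiff ℝ ∞ g := by
    rw [funext hg]
    exact (hF.smooth.clm_comp (h.smooth_plus.add h.smooth_minus)).const_smul (-(1 / 2) : ℝ)
  have sb : ContDiff ℝ ∞ b := by
    rw [funext hb]
    exact (hF.smooth.clm_comp (h.smooth_plus.sub h.smooth_minus)).const_smul (-(1 / 2) : ℝ)
  have hgs : ∀ q u v, g q u v = g q v u := by
    intro q u v
    simp only [hg, smul_apply, ContinuousLinearMap.comp_apply, add_apply, map_add, h.compat, hc]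
    rw [hF.skew q u, hF.skew q u, h.compat, hc]
    simp only [smul_eq_mul]
    ring
  have hbs : ∀ q u v, b q u v = -b q v u := by
    intro q u v
    simp only [hb, smul_apply, ContinuousLinearMap.comp_apply, sub_apply, map_sub, h.compat, hc]
    rw [hF.skew q u, hF.skew q u, h.compat, hc]
    simp only [smul_eq_mul]
    ring
  have hgp : ∀ q u v, g q (Ip q u) v = -g q u (Ip q v) := by
    intro q u v
    simp only [hg, smul_apply, ContinuousLinearMap.comp_apply, add_apply, map_add, h.sq_plus,
      hc, h.compat, map_neg, neg_apply, smul_eq_mul]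
    ring
  have hgm : ∀ q u v, g q (Im q u) v = -g q u (Im q v) := by
    intro q u v
    simp only [hg, smul_apply, ContinuousLinearMap.comp_apply, add_apply, map_add, h.sq_minus,
      hc, h.compat, map_neg, neg_apply, smul_eq_mul]
    ring
  have hgi : ∀ q, (g q).IsInvertible := fun q => isInvertible_of_pos (hpos q)
  have hplus : ∀ q x, b q x + g q x = -F q (Ip q x) := by
    intro q x
    simp only [hg, hb, smul_apply, ContinuousLinearMap.comp_apply, add_apply, sub_apply, map_add,
      map_sub]
    module
  have hminus : ∀ q x, b q x - g q x = F q (Im q x) := by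
    intro q x
    simp only [hg, hb, smul_apply, ContinuousLinearMap.comp_apply, add_apply, sub_apply, map_add,
      map_sub]
    module
  have Bp := fun q x => gualtieriB_plus (b := b) (hgi q) (h.sq_plus q) (h.sq_minus q) (hgp q)
    (hgm q) x
  have Bm := fun q x => gualtieriB_minus (b := b) (hgi q) (h.sq_plus q) (h.sq_minus q) (hgp q)
    (hgm q) x
  have Ap := fun q x => gualtieriA_plus (b := b) (hgi q) (h.sq_plus q) (h.sq_minus q) (hgp q)
    (hgm q) x
  have Am := fun q x => gualtieriA_minus (b := b) (hgi q) (h.sq_plus q) (h.sq_minus q) (hgp q)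
    (hgm q) x
  -- Invertibility of `g` makes the two graphs complementary; the axioms below are checked on each
  -- of them separately.
  have hdec : ∀ q (v : GTangent E), ∃ x y, v = (x, b q x + g q x) + (y, b q y - g q y) := by
    rintro q ⟨z, ζ⟩
    refine ⟨(1 / 2 : ℝ) • (z + (g q).inverse (ζ - b q z)),
      (1 / 2 : ℝ) • (z - (g q).inverse (ζ - b q z)), ?_⟩
    ext1
    · simp only [Prod.mk_add_mk]
      module
    · simp only [Prod.mk_add_mk, map_smul, map_add, map_sub ((g q)), map_sub (b q),
        apply_inverse_apply (hgi q)]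
      module
  have hA : gualtieriA g b Ip Im = symplecticGC F := by
    funext q
    refine ContinuousLinearMap.ext fun v => ?_
    obtain ⟨x, y, rfl⟩ := hdec q v
    rw [map_add, map_add, Ap, Am]
    simp only [hplus, hminus, symplecticGC_apply, map_neg, h.sq_plus, h.sq_minus, neg_neg,
      inverse_apply_of_eq (hFi q) rfl, Prod.neg_mk]
  -- The contributions of `b` cancel by skewness, leaving `g` on one graph, `-g` on the other, and
  -- no mixed terms.
  have orth : ∀ q x y x' y', gpairing ((x, b q x + g q x) + (y, b q y - g q y))
      ((x', b q x' + g q x') + (y', b q y' - g q y')) = g q x x' - g q y y' := by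
    intro q x y x' y'
    simp only [gpairing, Prod.mk_add_mk, map_add, add_apply, sub_apply]
    rw [hgs q x' x, hgs q x' y, hgs q y' x, hgs q y' y, hbs q x' x, hbs q x' y, hbs q y' x,
      hbs q y' y]
    ring
  have gIp : ∀ q u v, g q (Ip q u) (Ip q v) = g q u v := by
    intro q u v
    rw [hgp, h.sq_plus, map_neg, neg_neg]
  have gIm : ∀ q u v, g q (Im q u) (Im q v) = g q u v := by
    intro q u v
    rw [hgm, h.sq_minus, map_neg, neg_neg]
  have negm : ∀ q y, -((y, b q y - g q y) : GTangent E) = (-y, b q (-y) - g q (-y)) := by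
    intro q y
    simp only [Prod.neg_mk, map_neg, neg_sub, Prod.mk.injEq, true_and]
    abel
  refine ⟨⟨sg, hgs, hpos⟩, ⟨⟨?_, ?_, ?_, ?_⟩, ⟨?_, ?_, ?_, ?_⟩, ?_, ?_⟩, hA⟩
  · rw [hA, contDiff_clm_apply_iff]
    rintro ⟨x, ξ⟩
    have hi := contDiff_inverse hF.smooth hFi
    have hs := hF.smooth
    simp only [symplecticGC_apply]
    fun_prop
  · intro q v
    obtain ⟨x, y, rfl⟩ := hdec q v
    simp only [map_add (gualtieriA g b Ip Im q), map_neg (gualtieriA g b Ip Im q), Ap, Am, neg_neg]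
    simp only [h.sq_plus, h.sq_minus, map_neg, Prod.mk_add_mk, Prod.neg_mk, Prod.mk.injEq]
    constructor <;> abel
  · intro q v w
    obtain ⟨x, y, rfl⟩ := hdec q v
    obtain ⟨x', y', rfl⟩ := hdec q w
    simp only [map_add (gualtieriA g b Ip Im q), Ap, Am, negm]
    rw [orth, orth]
    simp only [map_neg, neg_apply, neg_neg, gIp, gIm]
  · rw [hA]
    exact hF.involutive
  · exact contDiff_gualtieriB hgi h.sq_plus h.sq_minus sg sb h.smooth_plus h.smooth_minus
  · intro q v
    obtain ⟨x, y, rfl⟩ := hdec q v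
    simp only [map_add, Bp, Bm, map_neg, h.sq_plus, h.sq_minus]
    simp only [Prod.mk_add_mk, Prod.neg_mk, Prod.mk.injEq]
    constructor <;> abel
  · intro q v w
    obtain ⟨x, y, rfl⟩ := hdec q v
    obtain ⟨x', y', rfl⟩ := hdec q w
    simp only [map_add, Bp, Bm]
    rw [orth, orth, gIp, gIm]
  · simp only [hplus, hminus, h.sq_plus, h.sq_minus, map_neg, neg_neg] at Bp Bm hdec
    exact h.involutive Bp Bm hdec
  · intro q v
    obtain ⟨x, y, rfl⟩ := hdec q v
    simp only [map_add (gualtieriA g b Ip Im q), map_add (gualtieriB g b Ip Im q),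
      map_neg (gualtieriB g b Ip Im q), Ap, Am, Bp, Bm]
  · intro q v hv
    obtain ⟨x, y, rfl⟩ := hdec q v
    -- The operator `-J_A J_B` is `+1` on the graph of `b + g` and `-1` on that of `b - g`, which
    -- turns the indefinite pairing into `g(x, x) + g(y, y)`.
    have e : -(gualtieriA g b Ip Im q (gualtieriB g b Ip Im q
        ((x, b q x + g q x) + (y, b q y - g q y))))
        = (x, b q x + g q x) + (-y, b q (-y) - g q (-y)) := by
      simp only [map_add, Ap, Am, Bp, Bm, map_neg, h.sq_plus, h.sq_minus]
      simp only [Prod.mk_add_mk, Prod.neg_mk, Prod.mk.injEq]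
      constructor <;> abel
    rw [e, orth]
    simp only [map_neg, neg_apply, sub_neg_eq_add]
    have nn : ∀ z, 0 ≤ g q z z := by
      intro z
      rcases eq_or_ne z 0 with rfl | hz
      · simp
      · exact (hpos q z hz).le
    by_cases hx : x = 0
    · have hy : y ≠ 0 := by
        rintro rfl
        apply hv
        simp [hx]
      have := hpos q y hy
      have := nn x
      linarith
    · have := hpos q x hx
      have := nn y
      linarith

end HermitianPair

/-! ### The dilogarithm and its derivative. -/

/-- The function `log (1 + r) / r`, continued by `1` at `r = 0`. -/
def logSlope : ℝ → ℝ := dslope (fun r => Real.log (1 + r)) 0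

theorem mul_logSlope (r : ℝ) : r * logSlope r = Real.log (1 + r) := by
  have := sub_smul_dslope (fun r => Real.log (1 + r)) 0 r
  simpa [logSlope] using this

theorem analyticAt_logSlope {r : ℝ} (hr : -1 < r) : AnalyticAt ℝ logSlope r := by
  have ha : ∀ s : ℝ, -1 < s → AnalyticAt ℝ (fun r => Real.log (1 + r)) s := by
    intro s hs
    exact (analyticAt_const.add analyticAt_id).log (show 0 < 1 + s by linarith)
  rcases eq_or_ne r 0 with rfl | h
  · obtain ⟨p, hp⟩ := ha 0 (by norm_num)
    exact ⟨_, hp.has_fpower_series_dslope_fslope⟩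
  · have h1 : AnalyticAt ℝ (fun r => Real.log (1 + r) / r) r :=
      (ha r hr).div analyticAt_id h
    refine h1.congr ?_
    filter_upwards [isOpen_ne.mem_nhds h] with s hs
    rw [← mul_logSlope, mul_div_cancel_left₀ _ hs]

theorem hasDerivAt_logSlope {r : ℝ} (hr : -1 < r) :
    HasDerivAt logSlope (deriv logSlope r) r :=
  (analyticAt_logSlope hr).differentiableAt.hasDerivAt

/-- Obtained by differentiating `r · logSlope r = log (1 + r)`. This is the identity through which
`β = 1 / (1 + |q₂|²)` arises from the potential. -/
theorem logSlope_add_mul_deriv {r : ℝ} (hr : -1 < r) :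
    logSlope r + r * deriv logSlope r = 1 / (1 + r) := by
  have h1 := (hasDerivAt_id r).mul (hasDerivAt_logSlope hr)
  have h2 : HasDerivAt (fun r : ℝ => Real.log (1 + r)) (1 / (1 + r)) r :=
    ((hasDerivAt_id r).const_add 1).log (by simp only [id]; linarith)
  have h3 : (id * logSlope : ℝ → ℝ) = fun r => Real.log (1 + r) := by
    funext s
    simp [mul_logSlope]
  rw [h3] at h1
  have := h1.unique h2
  simpa using this

theorem dilog_neg (r : ℝ) : dilog (-r) = -∫ s in (0 : ℝ)..r, logSlope s := by
  have h := intervalIntegral.integral_comp_neg (a := 0) (b := r)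
    (fun u => Real.log (1 - u) / u)
  have h2 : (∫ s in (0 : ℝ)..r, Real.log (1 - -s) / -s) = -∫ s in (0 : ℝ)..r, logSlope s := by
    rw [← intervalIntegral.integral_neg]
    refine intervalIntegral.integral_congr_ae ?_
    -- The integrands differ at `s = 0`, where the quotient takes the default value `0` and
    -- `logSlope` is `1`; a single point is negligible.
    have : ∀ᵐ s : ℝ, s ≠ 0 := by
      simp [MeasureTheory.ae_iff]
    filter_upwards [this] with s hs _
    rw [sub_neg_eq_add, ← mul_logSlope]
    field_simp
  rw [dilog, intervalIntegral.integral_symm, neg_neg, ← h2, h, neg_zero]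

theorem hasDerivAt_dilog_neg {r : ℝ} (hr : -1 < r) :
    HasDerivAt (fun s => -dilog (-s)) (logSlope r) r := by
  have e : (fun s => -dilog (-s)) = fun s => ∫ t in (0 : ℝ)..s, logSlope t := by
    funext s
    rw [dilog_neg, neg_neg]
  rw [e]
  have hc : ContinuousOn logSlope (Set.Ioi (-1)) := fun s hs =>
    (analyticAt_logSlope hs).continuousAt.continuousWithinAt
  refine intervalIntegral.integral_hasDerivAt_right ?_ ?_ (analyticAt_logSlope hr).continuousAt
  · refine (hc.mono ?_).intervalIntegrable
    intro s hs
    exact lt_of_lt_of_le (lt_min (by norm_num) hr) hs.1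
  · exact hc.stronglyMeasurableAtFilter isOpen_Ioi r hr

theorem contDiffAt_dilog_neg {r : ℝ} (hr : -1 < r) :
    ContDiffAt ℝ ∞ (fun s => -dilog (-s)) r := by
  have : ContDiffOn ℝ ∞ (fun s => -dilog (-s)) (Set.Ioi (-1)) := by
    rw [contDiffOn_infty_iff_deriv_of_isOpen isOpen_Ioi]
    refine ⟨fun s hs => (hasDerivAt_dilog_neg hs).differentiableAt.differentiableWithinAt, ?_⟩
    refine ContDiffOn.congr (f := logSlope) (fun s hs =>
      (analyticAt_logSlope hs).contDiffAt.contDiffWithinAt) ?_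
    exact fun s hs => (hasDerivAt_dilog_neg hs).deriv
  exact this.contDiffAt (Ioi_mem_nhds hr)

/-! ### Derivatives on `ℂ²` -/

theorem neg_one_lt_norm_sq (z : ℂ) : (-1 : ℝ) < ‖z‖ ^ 2 := by
  have := sq_nonneg ‖z‖
  linarith

theorem contDiff_logSlope_norm_sq : ContDiff ℝ ∞ fun q : C2 => logSlope (‖q.2‖ ^ 2) := by
  rw [contDiff_iff_contDiffAt]
  intro q
  exact ((analyticAt_logSlope (neg_one_lt_norm_sq q.2)).contDiffAt).comp q
    (contDiff_snd.norm_sq ℝ).contDiffAt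

theorem contDiff_potential (C : ℝ) : ContDiff ℝ ∞ (potential C) := by
  have h1 : ContDiff ℝ ∞ fun q : C2 => -dilog (-‖q.2‖ ^ 2) := by
    rw [contDiff_iff_contDiffAt]
    intro q
    exact ContDiffAt.comp (g := fun s => -dilog (-s)) q
      (contDiffAt_dilog_neg (neg_one_lt_norm_sq q.2))
      (contDiff_snd.norm_sq ℝ).contDiffAt
  have h2 : ContDiff ℝ ∞ fun q : C2 => ‖q.1‖ ^ 2 / C := (contDiff_fst.norm_sq ℝ).div_const C
  have e : potential C = fun q => ‖q.1‖ ^ 2 / C + -dilog (-‖q.2‖ ^ 2) := by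
    funext q
    rw [potential, sub_eq_add_neg]
  rw [e]
  exact h2.add h1

theorem hasFDerivAt_norm_sq_fst (q : C2) :
    HasFDerivAt (fun q : C2 => ‖q.1‖ ^ 2)
      (2 • (innerSL ℝ q.1).comp (ContinuousLinearMap.fst ℝ ℂ ℂ)) q :=
  hasFDerivAt_fst.norm_sq

theorem hasFDerivAt_norm_sq_snd (q : C2) :
    HasFDerivAt (fun q : C2 => ‖q.2‖ ^ 2)
      (2 • (innerSL ℝ q.2).comp (ContinuousLinearMap.snd ℝ ℂ ℂ)) q :=
  hasFDerivAt_snd.norm_sq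

theorem fderiv_potential (C : ℝ) (q u : C2) :
    fderiv ℝ (fun p => (potential C p : ℂ)) q u =
      ((2 / C * (q.1.re * u.1.re + q.1.im * u.1.im)
        + logSlope (‖q.2‖ ^ 2) * (2 * (q.2.re * u.2.re + q.2.im * u.2.im)) : ℝ) : ℂ) := by
  have h1 := (hasFDerivAt_norm_sq_fst q).mul_const (C⁻¹)
  have h2 := (hasDerivAt_dilog_neg (neg_one_lt_norm_sq q.2)).comp_hasFDerivAt q
    (hasFDerivAt_norm_sq_snd q)
  have h3 := Complex.ofRealCLM.hasFDerivAt.comp q (h1.add h2)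
  have e : (fun p => (potential C p : ℂ)) = Complex.ofRealCLM ∘ ((fun p : C2 => ‖p.1‖ ^ 2 * C⁻¹) +
      (fun s => -dilog (-s)) ∘ fun p : C2 => ‖p.2‖ ^ 2) := by
    funext p
    simp [potential, div_eq_mul_inv, sub_eq_add_neg]
  rw [e, h3.fderiv]
  simp [Complex.inner]
  ring

theorem fderiv_logSlope_norm_sq (q u : C2) :
    fderiv ℝ (fun p : C2 => logSlope (‖p.2‖ ^ 2)) q u =
      deriv logSlope (‖q.2‖ ^ 2) * (2 * (q.2.re * u.2.re + q.2.im * u.2.im)) := by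
  have h2 := (hasDerivAt_logSlope (neg_one_lt_norm_sq q.2)).comp_hasFDerivAt q
    (hasFDerivAt_norm_sq_snd q)
  have e : (fun p : C2 => logSlope (‖p.2‖ ^ 2)) = logSlope ∘ fun p : C2 => ‖p.2‖ ^ 2 := rfl
  rw [e, h2.fderiv]
  simp only [smul_apply, ContinuousLinearMap.comp_apply, innerSL_apply_apply, Complex.inner,
    ContinuousLinearMap.coe_snd', smul_eq_mul, nsmul_eq_mul]
  simp
  left
  ring

theorem dWirt_fst_potential (C : ℝ) (q : C2) :
    dWirt (1, 0) (fun p => (potential C p : ℂ)) q = starRingEnd ℂ q.1 / C := by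
  simp only [dWirt, fderiv_potential]
  apply Complex.ext <;> simp <;> ring

theorem dWirt_snd_potential (C : ℝ) (q : C2) :
    dWirt (0, 1) (fun p => (potential C p : ℂ)) q
      = logSlope (‖q.2‖ ^ 2) * starRingEnd ℂ q.2 := by
  simp only [dWirt, fderiv_potential]
  apply Complex.ext <;> simp <;> ring

theorem dWirtBar_fst_potential (C : ℝ) (q : C2) :
    dWirtBar (1, 0) (fun p => (potential C p : ℂ)) q = q.1 / C := by
  simp only [dWirtBar, fderiv_potential]
  apply Complex.ext <;> simp <;> ring

theorem dWirtBar_snd_potential (C : ℝ) (q : C2) :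
    dWirtBar (0, 1) (fun p => (potential C p : ℂ)) q = logSlope (‖q.2‖ ^ 2) * q.2 := by
  simp only [dWirtBar, fderiv_potential]
  apply Complex.ext <;> simp <;> ring

theorem norm_sq_eq_re_im (z : ℂ) : ‖z‖ ^ 2 = z.re * z.re + z.im * z.im := by
  rw [← Complex.normSq_eq_norm_sq, Complex.normSq_apply]

theorem fderiv_fst_div (C : ℝ) (q u : C2) : fderiv ℝ (fun p : C2 => p.1 / (C : ℂ)) q u = u.1 / C := by
  have : (fun p : C2 => p.1 / (C : ℂ)) = fun p => (C : ℂ)⁻¹ • ContinuousLinearMap.fst ℝ ℂ ℂ p := by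
    funext p
    simp [div_eq_inv_mul]
  have h := (ContinuousLinearMap.fst ℝ ℂ ℂ).hasFDerivAt (x := q) |>.const_smul ((C : ℂ)⁻¹)
  rw [this]
  refine (congrArg (· u) h.fderiv).trans ?_
  simp [div_eq_inv_mul]

theorem differentiable_logSlope_norm_sq :
    Differentiable ℝ fun p : C2 => logSlope (‖p.2‖ ^ 2) :=
  contDiff_logSlope_norm_sq.differentiable (by simp)

theorem fderiv_logSlope_smul {f : C2 → ℂ} {q : C2} (hf : DifferentiableAt ℝ f q) (u : C2) :
    fderiv ℝ (fun p : C2 => (logSlope (‖p.2‖ ^ 2) : ℂ) * f p) q u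
      = ((deriv logSlope (‖q.2‖ ^ 2) * (2 * (q.2.re * u.2.re + q.2.im * u.2.im)) : ℝ) : ℂ) * f q
        + logSlope (‖q.2‖ ^ 2) * fderiv ℝ f q u := by
  have : (fun p : C2 => (logSlope (‖p.2‖ ^ 2) : ℂ) * f p)
      = fun p => logSlope (‖p.2‖ ^ 2) • f p := by
    funext p
    simp
  rw [this, fderiv_fun_smul (differentiable_logSlope_norm_sq q) hf]
  simp only [add_apply, smul_apply, ContinuousLinearMap.smulRight_apply, fderiv_logSlope_norm_sq,
    Complex.real_smul]
  ring

/-- The mixed terms vanish because `K` is a sum of functions of `q₁` and of `q₂`. The last entry is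
`φ + |q₂|² φ'` with `φ = logSlope`, taken at `|q₂|²`. -/
theorem levi_potential (C : ℝ) (q : C2) :
    levi (potential C) (1, 0) (1, 0) q = ((1 / C : ℝ) : ℂ) ∧
    levi (potential C) (0, 1) (1, 0) q = 0 ∧ levi (potential C) (1, 0) (0, 1) q = 0 ∧
    levi (potential C) (0, 1) (0, 1) q = ((1 / (1 + ‖q.2‖ ^ 2) : ℝ) : ℂ) := by
  have key := logSlope_add_mul_deriv (neg_one_lt_norm_sq q.2)
  have d2 : fderiv ℝ (fun p : C2 => p.2) q = ContinuousLinearMap.snd ℝ ℂ ℂ := fderiv_snd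
  have hd : DifferentiableAt ℝ (fun p : C2 => p.2) q := differentiableAt_snd
  simp only [levi, funext (dWirtBar_fst_potential C), funext (dWirtBar_snd_potential C)]
  simp only [dWirt, fderiv_fst_div, fderiv_logSlope_smul hd, d2]
  refine ⟨?_, ?_, ?_, ?_⟩
  · apply Complex.ext <;> simp
    ring
  · simp
  · simp
  · rw [← key]
    apply Complex.ext
    · simp [norm_sq_eq_re_im]
      ring
    · simp [norm_sq_eq_re_im]
      ring

/-! ### The groupoid form -/

theorem fderiv_gpd_fst (z u : Gpd) : fderiv ℂ (fun w : Gpd => w.1) z u = u.1 := by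
  exact congrArg (· u) (hasFDerivAt_id (𝕜 := ℂ) z).fst.fderiv

theorem fderiv_gpd_snd (z u : Gpd) : fderiv ℂ (fun w : Gpd => w.2.1) z u = u.2.1 := by
  exact congrArg (· u) (hasFDerivAt_id (𝕜 := ℂ) z).snd.fst.fderiv

theorem fderiv_gpd_third (z u : Gpd) : fderiv ℂ (fun w : Gpd => w.2.2.1) z u = u.2.2.1 := by
  exact congrArg (· u) (hasFDerivAt_id (𝕜 := ℂ) z).snd.snd.fst.fderiv

theorem fderiv_gpd_fourth (z u : Gpd) : fderiv ℂ (fun w : Gpd => w.2.2.2) z u = u.2.2.2 := by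
  exact congrArg (· u) (hasFDerivAt_id (𝕜 := ℂ) z).snd.snd.snd.fderiv

theorem fderiv_gpd_moment (z u : Gpd) :
    fderiv ℂ (fun w : Gpd => w.2.2.2 + w.2.2.1 * w.2.1) z u
      = u.2.2.2 + (z.2.2.1 * u.2.1 + z.2.1 * u.2.2.1) := by
  have h := hasFDerivAt_id (𝕜 := ℂ) z
  refine (congrArg (· u) (h.snd.snd.snd.add (h.snd.snd.fst.mul h.snd.fst)).fderiv).trans ?_
  simp

theorem wedge_apply {V : Type*} [NormedAddCommGroup V] [NormedSpace ℂ V] (α β : V →L[ℂ] ℂ)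
    (u v : V) : wedge α β u v = α u * β v - β u * α v := rfl

theorem groupoidForm_apply (z u v : Gpd) : groupoidForm z u v
    = u.1 * (v.2.2.2 + (z.2.2.1 * v.2.1 + z.2.1 * v.2.2.1))
      - (u.2.2.2 + (z.2.2.1 * u.2.1 + z.2.1 * u.2.2.1)) * v.1
      - (u.2.1 * v.2.2.1 - u.2.2.1 * v.2.1) := by
  simp only [groupoidForm, sub_apply, wedge_apply, fderiv_gpd_moment, fderiv_gpd_fst,
    fderiv_gpd_snd, fderiv_gpd_third]

theorem fderiv_source (z u : Gpd) : fderiv ℂ source z u = (u.2.2.1, u.2.2.2) := by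
  have h := hasFDerivAt_id (𝕜 := ℂ) z
  have := (h.snd.snd.fst.prodMk h.snd.snd.snd).fderiv
  exact congrArg (· u) this

theorem fderiv_target (z u : Gpd) : fderiv ℂ target z u =
    (Complex.exp z.1 * (u.2.2.1 + z.2.2.1 * u.1),
      u.2.2.2 + (z.2.2.1 * u.2.1 + z.2.1 * u.2.2.1)) := by
  have h := hasFDerivAt_id (𝕜 := ℂ) z
  have := ((h.fst.cexp.mul h.snd.snd.fst).prodMk
    (h.snd.snd.snd.add (h.snd.snd.fst.mul h.snd.fst))).fderiv
  refine (congrArg (· u) this).trans ?_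
  simp
  ring

/-- On the target `d log(eᵃ x) = da + dx / x`; the terms with a pole cancel in the difference,
leaving `da ∧ d(y + x b) + dx ∧ db`. -/
theorem groupoidForm_eq_pullback (z : Gpd) (hz : z.2.2.1 ≠ 0) (u v : Gpd) :
    groupoidForm z u v =
      meromorphicForm (target z) (fderiv ℂ target z u) (fderiv ℂ target z v)
        - meromorphicForm (source z) (fderiv ℂ source z u) (fderiv ℂ source z v) := by
  have he := Complex.exp_ne_zero z.1
  rw [groupoidForm_apply]
  simp only [meromorphicForm, smul_apply, wedge_apply, fderiv_source, fderiv_target, source,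
    target, ContinuousLinearMap.coe_fst', ContinuousLinearMap.coe_snd', smul_eq_mul]
  field_simp
  ring

theorem fderiv_darboux (z u : Gpd) : fderiv ℂ darboux z u =
    (u.1, -u.2.1, u.2.2.2 + (z.2.2.1 * u.2.1 + z.2.1 * u.2.2.1), u.2.2.1) := by
  have h := hasFDerivAt_id (𝕜 := ℂ) z
  have := (h.fst.prodMk (h.snd.fst.neg.prodMk
    ((h.snd.snd.snd.add (h.snd.snd.fst.mul h.snd.fst)).prodMk h.snd.snd.fst))).fderiv
  refine (congrArg (· u) this).trans ?_
  simp

theorem canonicalForm_darboux (z u v : Gpd) :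
    canonicalForm (darboux z) (fderiv ℂ darboux z u) (fderiv ℂ darboux z v)
      = groupoidForm z u v := by
  rw [groupoidForm_apply]
  simp only [canonicalForm, add_apply, wedge_apply, fderiv_darboux, fderiv_gpd_fst,
    fderiv_gpd_snd, fderiv_gpd_third, fderiv_gpd_fourth]
  ring

/-! ### The brane -/

/-- The last coordinate is `y = q₁ + p₂ q₂`, and `|q₂|² logSlope |q₂|²` collapses to a logarithm. -/
theorem brane_potential (C : ℝ) (q : C2) : brane (potential C) q =
    (-Complex.I * (starRingEnd ℂ q.1 / C),
      Complex.I * (logSlope (‖q.2‖ ^ 2) * starRingEnd ℂ q.2), q.2,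
      q.1 - Complex.I * Real.log (1 + ‖q.2‖ ^ 2)) := by
  simp only [brane, darbouxInv, dWirt_fst_potential, dWirt_snd_potential, Prod.mk.injEq, true_and]
  refine ⟨by ring, ?_⟩
  rw [← mul_logSlope]
  have : starRingEnd ℂ q.2 * q.2 = ((‖q.2‖ ^ 2 : ℝ) : ℂ) := by
    rw [mul_comm, Complex.mul_conj, Complex.normSq_eq_norm_sq]
  push_cast at this ⊢
  linear_combination -Complex.I * logSlope (‖q.2‖ ^ 2) * this

theorem piMinus_potential (C : ℝ) (q : C2) :
    piMinus (potential C) q = (q.2, q.1 - Complex.I * Real.log (1 + ‖q.2‖ ^ 2)) := by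
  simp only [piMinus, source, brane_potential]

theorem piPlus_potential (C : ℝ) (q : C2) : piPlus (potential C) q =
    (Complex.exp (-Complex.I * (starRingEnd ℂ q.1 / C)) * q.2, q.1) := by
  simp only [piPlus, target, brane_potential, Prod.mk.injEq, true_and]
  rw [← mul_logSlope]
  have : starRingEnd ℂ q.2 * q.2 = ((‖q.2‖ ^ 2 : ℝ) : ℂ) := by
    rw [mul_comm, Complex.mul_conj, Complex.normSq_eq_norm_sq]
  push_cast at this ⊢
  linear_combination Complex.I * logSlope (‖q.2‖ ^ 2) * this

theorem hasFDerivAt_conj_fst (q : C2) : HasFDerivAt (fun p : C2 => starRingEnd ℂ p.1)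
    ((Complex.conjCLE : ℂ →L[ℝ] ℂ).comp (ContinuousLinearMap.fst ℝ ℂ ℂ)) q :=
  (Complex.conjCLE : ℂ →L[ℝ] ℂ).hasFDerivAt.comp q hasFDerivAt_fst

theorem hasFDerivAt_conj_snd (q : C2) : HasFDerivAt (fun p : C2 => starRingEnd ℂ p.2)
    ((Complex.conjCLE : ℂ →L[ℝ] ℂ).comp (ContinuousLinearMap.snd ℝ ℂ ℂ)) q :=
  (Complex.conjCLE : ℂ →L[ℝ] ℂ).hasFDerivAt.comp q hasFDerivAt_snd

theorem contDiff_conj_fst : ContDiff ℝ ∞ fun p : C2 => starRingEnd ℂ p.1 :=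
  (Complex.conjCLE : ℂ →L[ℝ] ℂ).contDiff.comp contDiff_fst

theorem contDiff_conj_snd : ContDiff ℝ ∞ fun p : C2 => starRingEnd ℂ p.2 :=
  (Complex.conjCLE : ℂ →L[ℝ] ℂ).contDiff.comp contDiff_snd

theorem contDiff_log_norm_sq {f : C2 → ℂ} (hf : ContDiff ℝ ∞ f) :
    ContDiff ℝ ∞ fun p : C2 => (Real.log (1 + ‖f p‖ ^ 2) : ℂ) :=
  Complex.ofRealCLM.contDiff.comp
    ((contDiff_const.add (hf.norm_sq ℝ)).log fun p => by positivity)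

theorem contDiff_brane (C : ℝ) : ContDiff ℝ ∞ (brane (potential C)) := by
  rw [funext (brane_potential C)]
  have h1 : ContDiff ℝ ∞ fun p : C2 => (logSlope (‖p.2‖ ^ 2) : ℂ) :=
    Complex.ofRealCLM.contDiff.comp contDiff_logSlope_norm_sq
  have h2 := contDiff_conj_fst
  have h3 := contDiff_conj_snd
  have h4 := contDiff_log_norm_sq (f := fun p => p.2) contDiff_snd
  exact (contDiff_const.mul (h2.div_const _)).prodMk ((contDiff_const.mul (h1.mul h3)).prodMk
    (contDiff_snd.prodMk (contDiff_fst.sub (contDiff_const.mul h4))))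

/-- `∂²K/∂q₂∂q̄₂`. -/
def beta (q : C2) : ℝ := 1 / (1 + ‖q.2‖ ^ 2)

theorem hasFDerivAt_log_norm_sq (q : C2) :
    HasFDerivAt (fun p : C2 => (Real.log (1 + ‖p.2‖ ^ 2) : ℂ))
      (Complex.ofRealCLM.comp ((1 + ‖q.2‖ ^ 2)⁻¹ •
        (2 • (innerSL ℝ q.2).comp (ContinuousLinearMap.snd ℝ ℂ ℂ)))) q := by
  have h1 := ((hasFDerivAt_norm_sq_snd q).const_add 1).log (by positivity)
  exact Complex.ofRealCLM.hasFDerivAt.comp q h1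

theorem fderiv_log_norm_sq (q u : C2) :
    fderiv ℝ (fun p : C2 => (Real.log (1 + ‖p.2‖ ^ 2) : ℂ)) q u
      = ((beta q * (2 * (q.2.re * u.2.re + q.2.im * u.2.im)) : ℝ) : ℂ) := by
  rw [(hasFDerivAt_log_norm_sq q).fderiv]
  simp only [smul_apply, ContinuousLinearMap.comp_apply, innerSL_apply_apply, Complex.inner,
    ContinuousLinearMap.coe_snd', smul_eq_mul, nsmul_eq_mul, Complex.ofRealCLM_apply, beta]
  simp
  left
  ring

theorem fderiv_piMinus (C : ℝ) (q u : C2) : fderiv ℝ (piMinus (potential C)) q u =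
    (u.2, u.1 - Complex.I *
      ((beta q * (2 * (q.2.re * u.2.re + q.2.im * u.2.im)) : ℝ) : ℂ)) := by
  rw [funext (piMinus_potential C)]
  have h := (hasFDerivAt_log_norm_sq q).differentiableAt.hasFDerivAt
  have := (hasFDerivAt_snd (𝕜 := ℝ) (p := q)).prodMk
    ((hasFDerivAt_fst (𝕜 := ℝ) (p := q)).sub (h.const_mul Complex.I))
  refine (congrArg (· u) this.fderiv).trans ?_
  simp [fderiv_log_norm_sq]

theorem fderiv_piPlus (C : ℝ) (q u : C2) : fderiv ℝ (piPlus (potential C)) q u =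
    (Complex.exp (-Complex.I * (starRingEnd ℂ q.1 / C)) *
      (u.2 - Complex.I * (starRingEnd ℂ u.1 / C) * q.2), u.1) := by
  rw [funext (piPlus_potential C)]
  have h := (((hasFDerivAt_conj_fst q).mul_const ((C : ℂ)⁻¹)).const_mul (-Complex.I)).cexp
  have := (h.mul (hasFDerivAt_snd (𝕜 := ℝ) (p := q))).prodMk
    (hasFDerivAt_fst (𝕜 := ℝ) (p := q))
  simp only [div_eq_mul_inv]
  refine (congrArg (· u) this.fderiv).trans ?_
  simp
  ring

theorem fderiv_brane (C : ℝ) (q u : C2) : fderiv ℝ (brane (potential C)) q u =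
    (-Complex.I * (starRingEnd ℂ u.1 / C),
      Complex.I * (((deriv logSlope (‖q.2‖ ^ 2) * (2 * (q.2.re * u.2.re + q.2.im * u.2.im)) : ℝ)
        : ℂ) * starRingEnd ℂ q.2 + logSlope (‖q.2‖ ^ 2) * starRingEnd ℂ u.2),
      u.2,
      u.1 - Complex.I * ((beta q * (2 * (q.2.re * u.2.re + q.2.im * u.2.im)) : ℝ) : ℂ)) := by
  rw [funext (brane_potential C)]
  have h0 := ((hasFDerivAt_conj_fst q).mul_const ((C : ℂ)⁻¹)).const_mul (-Complex.I)
  have hd : DifferentiableAt ℝ (fun p : C2 => (logSlope (‖p.2‖ ^ 2) : ℂ) * starRingEnd ℂ p.2) q :=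
    (Complex.ofRealCLM.differentiable.comp differentiable_logSlope_norm_sq q).mul
      (hasFDerivAt_conj_snd q).differentiableAt
  have h1 := hd.hasFDerivAt.const_mul Complex.I
  have h := (hasFDerivAt_log_norm_sq q).differentiableAt.hasFDerivAt
  have := h0.prodMk (h1.prodMk ((hasFDerivAt_snd (𝕜 := ℝ) (p := q)).prodMk
    ((hasFDerivAt_fst (𝕜 := ℝ) (p := q)).sub (h.const_mul Complex.I))))
  simp only [div_eq_mul_inv]
  refine (congrArg (· u) this.fderiv).trans ?_
  simp [fderiv_log_norm_sq, fderiv_logSlope_smul (hasFDerivAt_conj_snd q).differentiableAt,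
    (hasFDerivAt_conj_snd q).fderiv]
  ring

/-- The terms from `logSlope` and its derivative combine to `β`, and the imaginary parts cancel; the
Lagrangian condition is a consequence. -/
theorem braneForm_apply (C : ℝ) (q u v : C2) : braneForm (potential C) q u v =
    ((2 / C * (u.1.re * v.1.im - u.1.im * v.1.re)
      + 2 * beta q * (u.2.re * v.2.im - u.2.im * v.2.re) : ℝ) : ℂ) := by
  have key := logSlope_add_mul_deriv (neg_one_lt_norm_sq q.2)
  have e : braneForm (potential C) q u v = groupoidForm (brane (potential C) q)
    (fderiv ℝ (brane (potential C)) q u) (fderiv ℝ (brane (potential C)) q v) := rfl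
  rw [e, groupoidForm_apply]
  simp only [fderiv_brane, brane_potential]
  rw [beta, ← key, norm_sq_eq_re_im]
  generalize logSlope _ = φ
  generalize deriv logSlope _ = ψ
  obtain ⟨⟨a, b⟩, ⟨c, d⟩⟩ := q
  obtain ⟨⟨u₁, u₂⟩, ⟨u₃, u₄⟩⟩ := u
  obtain ⟨⟨v₁, v₂⟩, ⟨v₃, v₄⟩⟩ := v
  apply Complex.ext
  · simp
    ring
  · simp
    ring

theorem formF_apply (C : ℝ) (q u v : C2) : formF (potential C) q u v =
    2 / C * (u.1.re * v.1.im - u.1.im * v.1.re)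
      + 2 * beta q * (u.2.re * v.2.im - u.2.im * v.2.re) := by
  have : formF (potential C) q u v = (braneForm (potential C) q u v).re := rfl
  rw [this, braneForm_apply, Complex.ofReal_re]

theorem braneForm_eq_iddbar (C : ℝ) (q u v : C2) :
    braneForm (potential C) q u v = iddbar (potential C) q u v := by
  obtain ⟨h1, h2, h3, h4⟩ := levi_potential C q
  change _ = ((beta q : ℝ) : ℂ) at h4
  rw [braneForm_apply]
  simp only [iddbar, h1, h2, h3, h4, wedgeBar, ContinuousLinearMap.coe_fst',
    ContinuousLinearMap.coe_snd']
  generalize beta q = β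
  apply Complex.ext
  · simp
    ring
  · simp

theorem IsDiffeo.isInvertible_fderiv {f : C2 → C2} (hf : IsDiffeo f) (q : C2) :
    (fderiv ℝ f q).IsInvertible := by
  obtain ⟨sf, h, sh, hl, hr⟩ := hf
  have df := sf.differentiable (by simp)
  have dh := sh.differentiable (by simp)
  have e1 : (fderiv ℝ h (f q)).comp (fderiv ℝ f q) = ContinuousLinearMap.id ℝ C2 := by
    rw [← fderiv_comp q (dh _) (df _), hl.comp_eq_id, fderiv_id]
  have e2 : (fderiv ℝ f q).comp (fderiv ℝ h (f q)) = ContinuousLinearMap.id ℝ C2 := by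
    have := fderiv_comp (f q) (df (h (f q))) (dh (f q))
    rw [hl q] at this
    rw [← this, hr.comp_eq_id, fderiv_id]
  exact ⟨ContinuousLinearEquiv.equivOfInverse _ _ (fun v => congrArg (· v) e1)
    (fun v => congrArg (· v) e2), rfl⟩

/-- Up to exchanging coordinates the map translates `q₁` by a function of `q₂`, and the inverse
translates back. -/
theorem isDiffeo_piMinus (C : ℝ) : IsDiffeo (piMinus (potential C)) := by
  rw [funext (piMinus_potential C)]
  refine ⟨?_, fun z => (z.2 + Complex.I * Real.log (1 + ‖z.1‖ ^ 2), z.1), ?_, ?_, ?_⟩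
  · exact contDiff_snd.prodMk (contDiff_fst.sub (contDiff_const.mul
      (contDiff_log_norm_sq contDiff_snd)))
  · exact (contDiff_snd.add (contDiff_const.mul (contDiff_log_norm_sq contDiff_fst))).prodMk
      contDiff_fst
  · intro q
    simp
  · intro q
    simp

/-- Up to exchanging coordinates the map multiplies `q₂` by a nowhere vanishing function of `q₁`. -/
theorem isDiffeo_piPlus (C : ℝ) : IsDiffeo (piPlus (potential C)) := by
  rw [funext (piPlus_potential C)]
  refine ⟨?_, fun z => (z.2, Complex.exp (Complex.I * (starRingEnd ℂ z.2 / C)) * z.1),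
    ?_, ?_, ?_⟩
  · exact ((contDiff_const.mul (contDiff_conj_fst.div_const _)).cexp.mul contDiff_snd).prodMk
      contDiff_fst
  · exact contDiff_snd.prodMk
      ((contDiff_const.mul (contDiff_conj_snd.div_const _)).cexp.mul contDiff_fst)
  · intro q
    simp [← mul_assoc, ← Complex.exp_add]
  · intro q
    simp [← mul_assoc, ← Complex.exp_add]

theorem isBraneBisection_potential (C : ℝ) : IsBraneBisection (potential C) where
  smooth := contDiff_brane C
  lagrangian q u v := by rw [braneForm_apply, Complex.ofReal_im]
  target_diffeo := isDiffeo_piPlus C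
  source_diffeo := isDiffeo_piMinus C

/-! ### The symplectic form -/

theorem beta_pos (q : C2) : 0 < beta q := by
  unfold beta
  positivity

theorem beta_mul (q : C2) : beta q * (1 + ‖q.2‖ ^ 2) = 1 := by
  unfold beta
  field_simp

theorem contDiff_beta : ContDiff ℝ ∞ beta :=
  contDiff_const.div (contDiff_const.add (contDiff_snd.norm_sq ℝ)) fun q => by positivity

theorem fderiv_beta (q u : C2) : fderiv ℝ beta q u =
    -(beta q ^ 2 * (2 * (q.2.re * u.2.re + q.2.im * u.2.im))) := by
  have h0 : HasDerivAt (fun r : ℝ => (1 + r)⁻¹) (-1 / (1 + ‖q.2‖ ^ 2) ^ 2) (‖q.2‖ ^ 2) :=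
    ((hasDerivAt_id _).const_add 1).inv (by positivity)
  have h2 := h0.comp_hasFDerivAt q (hasFDerivAt_norm_sq_snd q)
  have e : beta = (fun r : ℝ => (1 + r)⁻¹) ∘ fun p : C2 => ‖p.2‖ ^ 2 := by
    funext p
    simp [beta]
  rw [e, h2.fderiv]
  simp only [smul_apply, ContinuousLinearMap.comp_apply, innerSL_apply_apply, Complex.inner,
    ContinuousLinearMap.coe_snd', smul_eq_mul, nsmul_eq_mul, Function.comp_apply]
  simp
  ring

theorem fderiv_clm_const_apply {E G H : Type*} [NormedAddCommGroup E] [NormedSpace ℝ E]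
    [NormedAddCommGroup G] [NormedSpace ℝ G] [NormedAddCommGroup H] [NormedSpace ℝ H]
    {A : E → G →L[ℝ] H} {q : E} (hA : DifferentiableAt ℝ A q) (w : E) (v : G) :
    fderiv ℝ A q w v = fderiv ℝ (fun p => A p v) q w := by
  rw [fderiv_clm_apply hA (differentiableAt_const v)]
  simp

theorem contDiff_formF (C : ℝ) : ContDiff ℝ ∞ (formF (potential C)) := by
  rw [contDiff_clm_apply_iff]
  intro u
  rw [contDiff_clm_apply_iff]
  intro v
  simp only [formF_apply]
  have := contDiff_beta
  fun_prop

theorem fderiv_formF (C : ℝ) (q u v w : C2) : fderiv ℝ (formF (potential C)) q u v w =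
    2 * -(beta q ^ 2 * (2 * (q.2.re * u.2.re + q.2.im * u.2.im)))
      * (v.2.re * w.2.im - v.2.im * w.2.re) := by
  have hd := (contDiff_formF C).differentiable (by simp)
  rw [fderiv_clm_const_apply (hd q), fderiv_clm_const_apply ((hd q).clm_apply
    (differentiableAt_const v))]
  simp only [formF_apply]
  have hb := (contDiff_beta.differentiable (by simp) q).hasFDerivAt
  have := ((hb.const_mul 2).mul_const (v.2.re * w.2.im - v.2.im * w.2.re)).const_add
    (2 / C * (v.1.re * w.1.im - v.1.im * w.1.re))
  rw [this.fderiv]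
  simp only [smul_apply, fderiv_beta, smul_eq_mul]
  ring

theorem isSymplecticForm_formF {C : ℝ} (hC : 1 < C) : IsSymplecticForm (formF (potential C)) where
  smooth := contDiff_formF C
  skew q u v := by
    simp only [formF_apply]
    ring
  closed q u v w := by
    simp only [fderiv_formF]
    ring
  nondegenerate q := by
    have hinj : Function.Injective (formF (potential C) q) := by
      rw [injective_iff_map_eq_zero]
      intro u hu
      -- Testing on `iu` makes the form definite: `F(u, iu) = (2/C)|u₁|² + 2β|u₂|²`.
      have h := congrArg (· (Complex.I • u)) hu
      simp only [formF_apply, zero_apply] at h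
      have hb := beta_pos q
      have hC0 : 0 < C := by linarith
      have h1 : 2 / C * (u.1.re ^ 2 + u.1.im ^ 2) + 2 * beta q * (u.2.re ^ 2 + u.2.im ^ 2) = 0 := by
        rw [← h]
        simp
        ring
      have h2 : 0 ≤ 2 / C * (u.1.re ^ 2 + u.1.im ^ 2) := by positivity
      have h3 : 0 ≤ 2 * beta q * (u.2.re ^ 2 + u.2.im ^ 2) := by positivity
      have h4 : u.1.re ^ 2 + u.1.im ^ 2 = 0 := by
        have : 2 / C * (u.1.re ^ 2 + u.1.im ^ 2) = 0 := by linarith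
        exact (mul_eq_zero.1 this).resolve_left (by positivity)
      have h5 : u.2.re ^ 2 + u.2.im ^ 2 = 0 := by
        have : 2 * beta q * (u.2.re ^ 2 + u.2.im ^ 2) = 0 := by linarith
        exact (mul_eq_zero.1 this).resolve_left (by positivity)
      ext1 <;> apply Complex.ext <;> simp only [Prod.fst_zero, Prod.snd_zero, Complex.zero_re,
        Complex.zero_im] <;> nlinarith
    refine ⟨hinj, ?_⟩
    have hd : Module.finrank ℝ C2 = Module.finrank ℝ (C2 →L[ℝ] ℝ) := by
      rw [← (LinearMap.toContinuousLinearMap (𝕜 := ℝ) (E := C2) (F' := ℝ)).finrank_eq]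
      exact Subspace.dual_finrank_eq.symm
    exact (LinearMap.injective_iff_surjective_of_finrank_eq_finrank
      (f := (formF (potential C) q).toLinearMap) hd).1 hinj

/-! ### The complex structures -/

/-- Verified in the form `Df (I u) = i Df u`, which determines the pulled back structure since `Df`
is invertible. -/
theorem iMinus_apply (C : ℝ) (q u : C2) : iMinus (potential C) q u =
    (Complex.I * u.1 + 2 * beta q * q.2 * starRingEnd ℂ u.2, Complex.I * u.2) := by
  refine inverse_apply_of_eq ((isDiffeo_piMinus C).isInvertible_fderiv q) ?_
  change _ = Complex.I • fderiv ℝ (piMinus (potential C)) q u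
  rw [fderiv_piMinus, fderiv_piMinus]
  ext1
  · simp
  · apply Complex.ext <;> simp <;> ring

theorem iPlus_apply (C : ℝ) (q u : C2) : iPlus (potential C) q u =
    (Complex.I * u.1, Complex.I * u.2 + 2 / C * q.2 * starRingEnd ℂ u.1) := by
  refine inverse_apply_of_eq ((isDiffeo_piPlus C).isInvertible_fderiv q) ?_
  change _ = Complex.I • fderiv ℝ (piPlus (potential C)) q u
  rw [fderiv_piPlus, fderiv_piPlus]
  ext1
  · simp
    linear_combination (2 * Complex.exp (-(Complex.I * ((starRingEnd ℂ) q.1 / C))) *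
      (starRingEnd ℂ u.1 / C) * q.2) * Complex.I_mul_I
  · simp

theorem contDiff_iMinus (C : ℝ) : ContDiff ℝ ∞ (iMinus (potential C)) := by
  rw [contDiff_clm_apply_iff]
  intro u
  simp only [iMinus_apply]
  have h : ContDiff ℝ ∞ fun q => (beta q : ℂ) := Complex.ofRealCLM.contDiff.comp contDiff_beta
  fun_prop

theorem contDiff_iPlus (C : ℝ) : ContDiff ℝ ∞ (iPlus (potential C)) := by
  rw [contDiff_clm_apply_iff]
  intro u
  simp only [iPlus_apply]
  fun_prop

theorem fderiv_iMinus (C : ℝ) (q w u : C2) : fderiv ℝ (iMinus (potential C)) q w u =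
    (2 * (((-(beta q ^ 2 * (2 * (q.2.re * w.2.re + q.2.im * w.2.im))) : ℝ) : ℂ) * q.2
      + beta q * w.2) * starRingEnd ℂ u.2, 0) := by
  rw [fderiv_clm_const_apply ((contDiff_iMinus C).differentiable (by simp) q)]
  simp only [iMinus_apply]
  have hb : HasFDerivAt (fun p => (beta p : ℂ)) (Complex.ofRealCLM.comp (fderiv ℝ beta q)) q :=
    Complex.ofRealCLM.hasFDerivAt.comp q
      (contDiff_beta.differentiable (by simp) q).hasFDerivAt
  have h := ((((hb.const_mul 2).mul (hasFDerivAt_snd (p := q))).mul_const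
    (starRingEnd ℂ u.2)).const_add (Complex.I * u.1)).prodMk
    (hasFDerivAt_const (Complex.I * u.2) q)
  refine (congrArg (· w) h.fderiv).trans ?_
  simp [fderiv_beta]
  ring

theorem fderiv_iPlus (C : ℝ) (q w u : C2) : fderiv ℝ (iPlus (potential C)) q w u =
    (0, 2 / C * w.2 * starRingEnd ℂ u.1) := by
  rw [fderiv_clm_const_apply ((contDiff_iPlus C).differentiable (by simp) q)]
  simp only [iPlus_apply]
  have h := (hasFDerivAt_const (𝕜 := ℝ) (Complex.I * u.1) q).prodMk
    ((((hasFDerivAt_snd (𝕜 := ℝ) (p := q)).const_mul (2 / (C : ℂ))).mul_const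
    (starRingEnd ℂ u.1)).const_add (Complex.I * u.2))
  refine (congrArg (· w) h.fderiv).trans ?_
  simp
  ring

theorem isHermitianPair_potential {C : ℝ} (hC : 1 < C) :
    IsHermitianPair (formF (potential C)) (iPlus (potential C)) (iMinus (potential C)) where
  symplectic := isSymplecticForm_formF hC
  smooth_plus := contDiff_iPlus C
  smooth_minus := contDiff_iMinus C
  sq_plus q v := by
    simp only [iPlus_apply]
    ext1 <;> apply Complex.ext <;> simp
    · ring
    · ring
  sq_minus q v := by
    simp only [iMinus_apply]
    ext1 <;> apply Complex.ext <;> simp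
    · ring
    · ring
  nijenhuis_plus q a c := by
    simp only [fderiv_iPlus, iPlus_apply]
    ext1 <;> apply Complex.ext <;> simp <;> ring
  nijenhuis_minus q a c := by
    simp only [fderiv_iMinus, iMinus_apply]
    ext1 <;> apply Complex.ext <;> simp <;> ring
  compat q u v := by
    simp only [iPlus_apply, iMinus_apply, formF_apply]
    have : (2 / C : ℂ) = ((2 / C : ℝ) : ℂ) := by push_cast; rfl
    rw [this]
    simp
    ring

/-! ### The Poisson structure -/

theorem covector_eq_coeff (η : C2 →L[ℝ] ℝ) (v : C2) :
    η v = 2 * (coeff (1, 0) η * v.1 + coeff (0, 1) η * v.2).re := by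
  have hv : v = v.1.re • ((1, 0) : C2) + v.1.im • (Complex.I • ((1, 0) : C2))
      + (v.2.re • ((0, 1) : C2) + v.2.im • (Complex.I • ((0, 1) : C2))) := by
    ext <;> simp
  have h := congrArg η hv
  simp only [map_add, map_smul, smul_eq_mul] at h
  rw [h]
  simp [coeff]
  ring

theorem realPoisson_apply (z : C2) (ζ : C2 →L[ℝ] ℝ) : realPoisson z ζ =
    (2 * Complex.I * z.1 * coeff (0, 1) ζ, -(2 * Complex.I * z.1) * coeff (1, 0) ζ) := rfl

/-- Writing the covector as `η ∘ Df` eliminates the transposed inverse; only an identity in `η`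
remains to be checked. -/
theorem pullbackPoisson_apply_of_eq {f : C2 → C2} {q : C2} (hf : (fderiv ℝ f q).IsInvertible)
    {ζ : C2 →L[ℝ] ℝ} {x : C2}
    (h : ∀ η : C2 →L[ℝ] ℝ, ζ = η.comp (fderiv ℝ f q) →
      fderiv ℝ f q x = realPoisson (f q) η) :
    pullbackPoisson f q ζ = x := by
  refine inverse_apply_of_eq hf (h _ ?_)
  refine ContinuousLinearMap.ext fun v => ?_
  change ζ v = ζ ((fderiv ℝ f q).inverse (fderiv ℝ f q v))
  rw [inverse_apply_of_eq hf rfl]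

theorem pullbackPoisson_piMinus (C : ℝ) (q : C2) (ζ : C2 →L[ℝ] ℝ) :
    pullbackPoisson (piMinus (potential C)) q ζ =
      (-(2 * Complex.I * q.2 * coeff (0, 1) ζ), 2 * Complex.I * q.2 * coeff (1, 0) ζ) := by
  refine pullbackPoisson_apply_of_eq ((isDiffeo_piMinus C).isInvertible_fderiv q) ?_
  rintro η rfl
  rw [realPoisson_apply, piMinus_potential, fderiv_piMinus, coeff, coeff]
  simp only [ContinuousLinearMap.comp_apply, fderiv_piMinus, covector_eq_coeff η]
  generalize coeff (1, 0) η = η₁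
  generalize coeff (0, 1) η = η₂
  ext1 <;> apply Complex.ext <;> simp <;> ring

theorem pullbackPoisson_piPlus (C : ℝ) (q : C2) (ζ : C2 →L[ℝ] ℝ) :
    pullbackPoisson (piPlus (potential C)) q ζ =
      (-(2 * Complex.I * q.2 * coeff (0, 1) ζ), 2 * Complex.I * q.2 * coeff (1, 0) ζ) := by
  refine pullbackPoisson_apply_of_eq ((isDiffeo_piPlus C).isInvertible_fderiv q) ?_
  rintro η rfl
  rw [realPoisson_apply, piPlus_potential, fderiv_piPlus, coeff, coeff]
  simp only [ContinuousLinearMap.comp_apply, fderiv_piPlus, covector_eq_coeff η]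
  generalize coeff (1, 0) η = η₁
  generalize coeff (0, 1) η = η₂
  generalize Complex.exp _ = e
  simp only [div_eq_mul_inv, ← Complex.ofReal_inv]
  ext1 <;> apply Complex.ext <;> simp <;> ring

theorem pullbackPoisson_eq (C : ℝ) :
    pullbackPoisson (piPlus (potential C)) = pullbackPoisson (piMinus (potential C)) := by
  funext q
  refine ContinuousLinearMap.ext fun ζ => ?_
  rw [pullbackPoisson_piPlus, pullbackPoisson_piMinus]

theorem iPlus_sub_iMinus (C : ℝ) (q : C2) : iPlus (potential C) q - iMinus (potential C) q
    = (pullbackPoisson (piMinus (potential C)) q).comp (formF (potential C) q) := by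
  refine ContinuousLinearMap.ext fun u => ?_
  simp only [sub_apply, ContinuousLinearMap.comp_apply, iPlus_apply, iMinus_apply,
    pullbackPoisson_piMinus, coeff, formF_apply]
  simp only [div_eq_mul_inv, ← Complex.ofReal_inv]
  ext1 <;> apply Complex.ext <;> simp <;> ring

theorem finrank_range_pullbackPoisson (C : ℝ) (q : C2) : Module.finrank ℝ
    (LinearMap.range (pullbackPoisson (piMinus (potential C)) q).toLinearMap)
      = if q.2 = 0 then 0 else 4 := by
  split_ifs with h
  · have : (pullbackPoisson (piMinus (potential C)) q).toLinearMap = 0 := by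
      ext1 ζ
      simp [pullbackPoisson_piMinus, h]
    rw [this, LinearMap.range_zero, finrank_bot]
  · have : LinearMap.range (pullbackPoisson (piMinus (potential C)) q).toLinearMap = ⊤ := by
      rw [LinearMap.range_eq_top]
      intro x
      -- The formula for `Q` is solved for the coefficients of `ζ`, and a real covector with these
      -- coefficients is `2 Re(ζ₁ dq₁ + ζ₂ dq₂)`.
      let ζ₁ := x.2 / (2 * Complex.I * q.2)
      let ζ₂ := -x.1 / (2 * Complex.I * q.2)
      let ζ : C2 →L[ℝ] ℝ := (2 : ℝ) • Complex.reCLM.comp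
        (ζ₁ • ContinuousLinearMap.fst ℝ ℂ ℂ + ζ₂ • ContinuousLinearMap.snd ℝ ℂ ℂ)
      have h1 : coeff (1, 0) ζ = ζ₁ := by
        simp only [coeff, ζ]
        apply Complex.ext <;> simp
      have h2 : coeff (0, 1) ζ = ζ₂ := by
        simp only [coeff, ζ]
        apply Complex.ext <;> simp
      refine ⟨ζ, ?_⟩
      change pullbackPoisson (piMinus (potential C)) q ζ = x
      rw [pullbackPoisson_piMinus, h1, h2]
      have hI := Complex.I_ne_zero
      ext1
      · simp only [ζ₂]
        field_simp
      · simp only [ζ₁]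
        field_simp
    rw [this, finrank_top, Module.finrank_prod, Complex.finrank_real_complex]

/-! ### The metric -/

theorem metricG_apply (C : ℝ) (q u v : C2) : metricG (potential C) q u v =
    2 / C * (u.1.re * v.1.re + u.1.im * v.1.im) + 2 * beta q * (u.2.re * v.2.re + u.2.im * v.2.im)
      - 2 / C * beta q * ((starRingEnd ℂ q.2 * u.2 * v.1).im
        + (starRingEnd ℂ q.2 * u.1 * v.2).im) := by
  have e : metricG (potential C) q u v = -(1 / 2) *
      formF (potential C) q (iPlus (potential C) q u + iMinus (potential C) q u) v := rfl
  have : (2 / C : ℂ) = ((2 / C : ℝ) : ℂ) := by push_cast; rfl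
  rw [e, formF_apply, iPlus_apply, iMinus_apply, this]
  simp
  ring

theorem metricG_self (C : ℝ) (q u : C2) : metricG (potential C) q u u =
    2 * (‖u.1‖ ^ 2 / C + beta q * ‖u.2‖ ^ 2
      - 2 / C * beta q * (starRingEnd ℂ q.2 * u.1 * u.2).im) := by
  rw [metricG_apply, norm_sq_eq_re_im, norm_sq_eq_re_im]
  simp
  ring

theorem metricG_eq (C : ℝ) (q u : C2) : ((metricG (potential C) q u u : ℝ) : ℂ) =
    2 * (1 / (C : ℂ) * (u.1 * starRingEnd ℂ u.1)
      + 1 / (1 + (‖q.2‖ : ℂ) ^ 2) * (u.2 * starRingEnd ℂ u.2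
        + Complex.I / (C : ℂ) * starRingEnd ℂ q.2 * u.1 * u.2
        - Complex.I / (C : ℂ) * q.2 * starRingEnd ℂ u.1 * starRingEnd ℂ u.2)) := by
  have : 1 / (1 + (‖q.2‖ : ℂ) ^ 2) = (beta q : ℂ) := by
    simp [beta]
  rw [metricG_apply, this]
  simp only [div_eq_mul_inv, ← Complex.ofReal_inv]
  apply Complex.ext <;> simp <;> ring

/-- Positivity with an explicit margin; pointwise positivity alone would not give completeness. With
`α = 1 / C`, `h = α|u₁|² + β|u₂|²` and `l = (1 + α) / 2`, the cross term is at most `l h`, so `g ≥ 2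
(1 - l) h = (1 - α) h`. -/
theorem le_metricG {C : ℝ} (hC : 1 < C) (q u : C2) :
    (1 - 1 / C) * (‖u.1‖ ^ 2 / C + beta q * ‖u.2‖ ^ 2) ≤ metricG (potential C) q u u := by
  rw [metricG_self]
  have hb := beta_pos q
  have hb1 := beta_mul q
  have him : (starRingEnd ℂ q.2 * u.1 * u.2).im ≤ ‖q.2‖ * ‖u.1‖ * ‖u.2‖ := by
    refine (Complex.abs_im_le_norm _ |>.trans' (le_abs_self _)).trans ?_
    simp
  have hC0 : 0 < C := by linarith
  rw [div_eq_mul_one_div (‖u.1‖ ^ 2), div_eq_mul_one_div 2 C]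
  have hα0 : 0 < 1 / C := by positivity
  have hα1 : 1 / C < 1 := by rw [div_lt_one hC0]; exact hC
  set α := 1 / C
  set β := beta q
  set s := ‖q.2‖
  set a := ‖u.1‖
  set b := ‖u.2‖
  have h1 : 2 * α * β * (starRingEnd ℂ q.2 * u.1 * u.2).im ≤ 2 * α * β * (s * a * b) := by
    gcongr
  set l := (1 + α) / 2 with hl
  have hl0 : 0 < l := by positivity
  -- Completing the square in `a` leaves the coefficient `l² - αβs²`. As `βs² = 1 - β` and `l² - α =
  -- ((1 - α) / 2)²`, it equals `((1 - α) / 2)² + αβ`.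
  have h2 : l * (l * (α * a ^ 2 + β * b ^ 2) - 2 * α * β * s * a * b)
      = α * (l * a - β * s * b) ^ 2 + β * b ^ 2 * (((1 - α) / 2) ^ 2 + α * β) := by
    have : β * s ^ 2 = 1 - β := by linarith
    rw [hl]
    linear_combination (-α * β * b ^ 2) * this
  have h3 : 0 ≤ l * (α * a ^ 2 + β * b ^ 2) - 2 * α * β * s * a * b := by
    have : 0 ≤ l * (l * (α * a ^ 2 + β * b ^ 2) - 2 * α * β * s * a * b) := by
      rw [h2]
      positivity
    exact nonneg_of_mul_nonneg_right this hl0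
  rw [hl] at h3
  linarith

theorem metricG_pos {C : ℝ} (hC : 1 < C) (q u : C2) (hu : u ≠ 0) :
    0 < metricG (potential C) q u u := by
  refine lt_of_lt_of_le ?_ (le_metricG hC q u)
  have hb := beta_pos q
  have hC0 : 0 < C := by linarith
  have hα1 : 0 < 1 - 1 / C := by
    rw [sub_pos, div_lt_one hC0]
    exact hC
  apply mul_pos hα1
  by_cases h : u.1 = 0
  · have : u.2 ≠ 0 := fun h' => hu (Prod.ext h h')
    positivity
  · positivity

theorem formF_comp_iPlus {C : ℝ} (hC : 1 < C) (q : C2) :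
    (formF (potential C) q).comp (iPlus (potential C) q)
      + (transpose (iMinus (potential C) q)).comp (formF (potential C) q) = 0 := by
  refine ContinuousLinearMap.ext fun u => ContinuousLinearMap.ext fun v => ?_
  change formF (potential C) q (iPlus (potential C) q u) v
    + formF (potential C) q u (iMinus (potential C) q v) = 0
  rw [(isHermitianPair_potential hC).compat, neg_add_cancel]

/-! ### Completeness -/

section Complete

open MeasureTheory Set

variable {E : Type*} [NormedAddCommGroup E] [NormedSpace ℝ E]

/-- The norm of a metric on the tangent spaces. -/
abbrev metricENorm (g : E → E →L[ℝ] (E →L[ℝ] ℝ)) (z : E) : ENorm (TangentSpace 𝓘(ℝ, E) z) :=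
  ⟨fun v : E => ENNReal.ofReal (Real.sqrt (g z v v))⟩

/-- Homogeneity is the only property of the pointwise norm that the path length estimates and the
triangle inequality for the distance ask for. -/
theorem metricENorm_smulClass (g : E → E →L[ℝ] (E →L[ℝ] ℝ)) (z : E) :
    letI := metricENorm g z
    ENormSMulClass ℝ (TangentSpace 𝓘(ℝ, E) z) := by
  suffices key : ∀ (c : ℝ) (v : E), ENNReal.ofReal (Real.sqrt (g z (c • v) (c • v)))
      = ‖c‖ₑ * ENNReal.ofReal (Real.sqrt (g z v v)) by
    let := metricENorm g z
    exact ⟨key⟩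
  intro c v
  rw [Real.enorm_eq_ofReal_abs, ← ENNReal.ofReal_mul (abs_nonneg c), ← Real.sqrt_sq_eq_abs,
    ← Real.sqrt_mul (sq_nonneg c)]
  simp only [map_smul, smul_apply, smul_eq_mul]
  congr 2
  ring

theorem metricEDist_triangle (g : E → E →L[ℝ] (E →L[ℝ] ℝ)) (x y z : E) :
    metricEDist g x z ≤ metricEDist g x y + metricEDist g y z := by
  let := metricENorm g
  have := metricENorm_smulClass g
  exact Manifold.riemannianEDist_triangle

theorem pathELength_metric (g : E → E →L[ℝ] (E →L[ℝ] ℝ)) (γ : ℝ → E) :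
    letI := metricENorm g
    Manifold.pathELength 𝓘(ℝ, E) γ 0 1 = ∫⁻ t in Icc (0 : ℝ) 1,
      ENNReal.ofReal (Real.sqrt (g (γ t) (derivWithin γ (Icc 0 1) t)
        (derivWithin γ (Icc 0 1) t))) := by
  let := metricENorm g
  rw [Manifold.pathELength_eq_lintegral_mfderivWithin_Icc]
  simp only [mfderivWithin_eq_fderivWithin]
  rfl

/-- The straight segment is an admissible path with constant velocity `y - x`; this bounds the
distance from above by Euclidean data. -/
theorem metricEDist_le_of_segment {g : E → E →L[ℝ] (E →L[ℝ] ℝ)} {x y : E} {M : ℝ}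
    (h : ∀ z ∈ segment ℝ x y, g z (y - x) (y - x) ≤ M) :
    metricEDist g x y ≤ ENNReal.ofReal (Real.sqrt M) := by
  let := metricENorm g
  have := metricENorm_smulClass g
  let γ := ContinuousAffineMap.lineMap (R := ℝ) x y
  have h1 : metricEDist g x y ≤ Manifold.pathELength 𝓘(ℝ, E) γ 0 1 := by
    apply Manifold.riemannianEDist_le_pathELength ?_
      (by simp [γ, ContinuousAffineMap.coe_lineMap_eq])
      (by simp [γ, ContinuousAffineMap.coe_lineMap_eq]) zero_le_one
    rw [contMDiffOn_iff_contDiffOn]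
    exact γ.contDiff.contDiffOn
  refine h1.trans ?_
  rw [pathELength_metric]
  have h2 : ∀ t ∈ Icc (0 : ℝ) 1, ENNReal.ofReal (Real.sqrt (g (γ t)
      (derivWithin γ (Icc 0 1) t) (derivWithin γ (Icc 0 1) t))) ≤
      ENNReal.ofReal (Real.sqrt M) := by
    intro t ht
    have hd : derivWithin γ (Icc 0 1) t = y - x := by
      have : HasDerivAt γ (y - x) t := AffineMap.hasDerivAt_lineMap
      exact this.hasDerivWithinAt.derivWithin (uniqueDiffOn_Icc zero_lt_one t ht)
    rw [hd]
    refine ENNReal.ofReal_le_ofReal (Real.sqrt_le_sqrt (h _ ?_))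
    rw [segment_eq_image_lineMap]
    exact ⟨t, ht, rfl⟩
  refine (setLIntegral_mono' measurableSet_Icc h2).trans ?_
  simp

/-- If `|df|` is at most the `g`-norm, then `f` maps each path to one that is no longer, so `f` is
1-Lipschitz. -/
theorem enorm_sub_le_metricEDist {G : Type*} [NormedAddCommGroup G] [NormedSpace ℝ G]
    [CompleteSpace G] {g : E → E →L[ℝ] (E →L[ℝ] ℝ)} {f : E → G} (hf : ContDiff ℝ 1 f)
    (h : ∀ z v, ‖fderiv ℝ f z v‖ ^ 2 ≤ g z v v) (x y : E) :
    ‖f y - f x‖ₑ ≤ metricEDist g x y := by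
  let := metricENorm g
  refine le_of_forall_gt fun r hr => ?_
  obtain ⟨γ, h0, h1, hγ, hlen⟩ := Manifold.exists_lt_of_riemannianEDist_lt hr
  rw [contMDiffOn_iff_contDiffOn] at hγ
  refine lt_of_le_of_lt ?_ hlen
  have hD : ContDiffOn ℝ 1 (f ∘ γ) (Icc 0 1) := hf.comp_contDiffOn hγ
  have := enorm_sub_le_lintegral_derivWithin_Icc_of_contDiffOn_Icc hD zero_le_one
  simp only [Function.comp_apply, h0, h1] at this
  refine this.trans ?_
  rw [pathELength_metric]
  refine setLIntegral_mono' measurableSet_Icc fun t ht => ?_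
  have hu := uniqueDiffOn_Icc (zero_lt_one' ℝ) t ht
  have hd : derivWithin (f ∘ γ) (Icc 0 1) t = fderiv ℝ f (γ t) (derivWithin γ (Icc 0 1) t) :=
    ((hf.differentiable one_ne_zero (γ t)).hasFDerivAt.comp_hasDerivWithinAt t
      ((hγ.differentiableOn one_ne_zero) t ht).hasDerivWithinAt).derivWithin hu
  change ‖derivWithin (f ∘ γ) (Icc 0 1) t‖ₑ ≤ _
  rw [hd, ← ofReal_norm]
  exact ENNReal.ofReal_le_ofReal (Real.le_sqrt_of_sq_le (h _ _))

/-- A metric on a finite dimensional space whose unit balls are bounded is complete. -/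
theorem isCompleteMetric_of_bounded [FiniteDimensional ℝ E] {g : E → E →L[ℝ] (E →L[ℝ] ℝ)}
    (hg : Continuous g) (hb : ∀ x, ∃ R : ℝ, ∀ y, metricEDist g x y < 1 → ‖y‖ ≤ R) :
    IsCompleteMetric g := by
  intro u hu
  obtain ⟨N, hN⟩ := hu 1 one_pos
  obtain ⟨R, hR⟩ := hb (u N)
  -- The tail of the Cauchy sequence stays in a unit ball of the metric, hence in a compact
  -- Euclidean ball, and has a Euclidean limit point `a`.
  have hbd : ∀ n, u (n + N) ∈ Metric.closedBall (0 : E) R := by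
    intro n
    rw [mem_closedBall_zero_iff]
    exact hR _ (hN N le_rfl _ (Nat.le_add_left N n))
  obtain ⟨a, -, φ, hφ, ha⟩ := tendsto_subseq_of_bounded Metric.isBounded_closedBall hbd
  refine ⟨a, ?_⟩
  obtain ⟨M, hM⟩ := IsCompact.exists_bound_of_continuousOn
    (E := E →L[ℝ] E →L[ℝ] ℝ) (isCompact_closedBall a 1) hg.continuousOn
  have hM0 : 0 ≤ M := (norm_nonneg _).trans (hM a (Metric.mem_closedBall_self zero_le_one))
  -- Near `a` the norm of `g` is at most `M`, so Euclidean convergence of the subsequence implies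
  -- convergence for the Riemannian distance.
  have hlim : Filter.Tendsto (fun n => metricEDist g (u (φ n + N)) a) Filter.atTop (nhds 0) := by
    have hup : Filter.Tendsto (fun n => ENNReal.ofReal (Real.sqrt (M * ‖a - u (φ n + N)‖ ^ 2)))
        Filter.atTop (nhds 0) := by
      have : Filter.Tendsto (fun n => Real.sqrt (M * ‖a - u (φ n + N)‖ ^ 2)) Filter.atTop
          (nhds (Real.sqrt (M * ‖a - a‖ ^ 2))) :=
        (((tendsto_const_nhds.sub ha).norm.pow 2).const_mul M).sqrt
      have h2 := ENNReal.tendsto_ofReal this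
      simpa using h2
    refine tendsto_of_tendsto_of_tendsto_of_le_of_le' tendsto_const_nhds hup
      (Filter.Eventually.of_forall fun _ => zero_le) ?_
    have hev := ha.eventually (Metric.closedBall_mem_nhds a one_pos)
    filter_upwards [hev] with n hn
    refine metricEDist_le_of_segment fun z hz => ?_
    have hz' := (convex_closedBall a 1).segment_subset hn
      (Metric.mem_closedBall_self zero_le_one) hz
    calc g z (a - u (φ n + N)) (a - u (φ n + N))
        ≤ ‖g z (a - u (φ n + N)) (a - u (φ n + N))‖ := le_abs_self _
      _ ≤ ‖g z‖ * ‖a - u (φ n + N)‖ * ‖a - u (φ n + N)‖ := (g z).le_opNorm₂ _ _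
      _ ≤ M * ‖a - u (φ n + N)‖ * ‖a - u (φ n + N)‖ := by
          gcongr
          exact hM z hz'
      _ = M * ‖a - u (φ n + N)‖ ^ 2 := by ring
  rw [ENNReal.tendsto_atTop_zero] at hlim ⊢
  intro ε hε
  have hε2 : 0 < ε / 2 := ENNReal.half_pos hε.ne'
  obtain ⟨N₁, hN₁⟩ := hu (ε / 2) hε2
  obtain ⟨N₂, hN₂⟩ := hlim (ε / 2) hε2
  refine ⟨N₁, fun n hn => ?_⟩
  set m := max N₁ N₂
  have hm : N₁ ≤ φ m + N := (le_max_left N₁ N₂).trans ((hφ.id_le m).trans (Nat.le_add_right _ _))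
  calc metricEDist g (u n) a
      ≤ metricEDist g (u n) (u (φ m + N)) + metricEDist g (u (φ m + N)) a :=
        metricEDist_triangle g _ _ _
    _ ≤ ε / 2 + ε / 2 := add_le_add (hN₁ n hn _ hm).le (hN₂ m (le_max_right _ _))
    _ = ε := ENNReal.add_halves ε

end Complete

theorem isCompleteMetric_metricG {C : ℝ} (hC : 1 < C) : IsCompleteMetric (metricG (potential C)) := by
  have hsmooth : ContDiff ℝ ∞ (metricG (potential C)) :=
    ((contDiff_formF C).clm_comp ((contDiff_iPlus C).add (contDiff_iMinus C))).const_smul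
      (-(1 / 2) : ℝ)
  refine isCompleteMetric_of_bounded hsmooth.continuous fun x => ?_
  have hC0 : 0 < C := by linarith
  have hα1 : 0 < 1 - 1 / C := by
    rw [sub_pos, div_lt_one hC0]
    exact hC
  -- The constant serves both functions below: `c²` is at most the coefficient `(1 - 1/C) / C` of
  -- `|dq₁|²`, and the denominator `4` cancels the square of the `2` in `d log(1 + |q₂|²) = 2β
  -- Re(q̄₂ dq₂)`.
  set c := Real.sqrt ((1 - 1 / C) * (1 / C) / 4) with hc
  have hc2 : c ^ 2 = (1 - 1 / C) * (1 / C) / 4 := Real.sq_sqrt (by positivity)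
  have hc0 : 0 < c := Real.sqrt_pos.2 (by positivity)
  have hle := le_metricG hC
  let f₁ : C2 → ℂ := fun q => c • q.1
  let f₂ : C2 → ℂ := fun q => c • (Real.log (1 + ‖q.2‖ ^ 2) : ℂ)
  have hf₁ : ContDiff ℝ 1 f₁ := contDiff_fst.const_smul c
  have hf₂ : ContDiff ℝ 1 f₂ :=
    ((contDiff_log_norm_sq contDiff_snd).of_le (by simp)).const_smul c
  have d₁ : ∀ z v, fderiv ℝ f₁ z v = c • v.1 := fun z v =>
    congrArg (· v) ((hasFDerivAt_fst (𝕜 := ℝ) (p := z)).const_smul c).fderiv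
  have d₂ : ∀ z v, fderiv ℝ f₂ z v
      = c • ((beta z * (2 * (z.2.re * v.2.re + z.2.im * v.2.im)) : ℝ) : ℂ) := fun z v =>
    (congrArg (· v) ((hasFDerivAt_log_norm_sq z).differentiableAt.hasFDerivAt.const_smul c).fderiv
      ).trans (congrArg (c • ·) (fderiv_log_norm_sq z v))
  have b₁ : ∀ z v, ‖fderiv ℝ f₁ z v‖ ^ 2 ≤ metricG (potential C) z v v := by
    intro z v
    refine le_trans ?_ (hle z v)
    have hb := beta_pos z
    rw [d₁, norm_smul, mul_pow, Real.norm_eq_abs, sq_abs, hc2]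
    have e1 : 0 ≤ (1 - 1 / C) * (‖v.1‖ ^ 2 * (1 / C)) * (3 / 4) := by positivity
    have e2 : 0 ≤ (1 - 1 / C) * (beta z * ‖v.2‖ ^ 2) := by positivity
    rw [div_eq_mul_one_div (‖v.1‖ ^ 2)]
    linarith
  have b₂ : ∀ z v, ‖fderiv ℝ f₂ z v‖ ^ 2 ≤ metricG (potential C) z v v := by
    intro z v
    refine le_trans ?_ (hle z v)
    have hb := beta_pos z
    have hbm := beta_mul z
    rw [d₂, norm_smul, mul_pow, Real.norm_eq_abs, sq_abs, hc2, Complex.norm_real, Real.norm_eq_abs,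
      sq_abs]
    have e0 : (z.2.re * v.2.re + z.2.im * v.2.im) ^ 2 ≤ ‖z.2‖ ^ 2 * ‖v.2‖ ^ 2 := by
      rw [norm_sq_eq_re_im, norm_sq_eq_re_im]
      nlinarith [sq_nonneg (z.2.re * v.2.im - z.2.im * v.2.re)]
    -- Cauchy–Schwarz and `β|q₂|² = 1 - β` give `β² |q₂|² |v₂|² = β (1 - β) |v₂|² ≤ β |v₂|²`: the
    -- decay of `β` is compensated by the logarithm.
    have e3 : beta z ^ 2 * (z.2.re * v.2.re + z.2.im * v.2.im) ^ 2 ≤ beta z * ‖v.2‖ ^ 2 := by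
      calc beta z ^ 2 * (z.2.re * v.2.re + z.2.im * v.2.im) ^ 2
          ≤ beta z ^ 2 * (‖z.2‖ ^ 2 * ‖v.2‖ ^ 2) := by gcongr
        _ = beta z * (1 - beta z) * ‖v.2‖ ^ 2 := by
          linear_combination beta z * ‖v.2‖ ^ 2 * hbm
        _ ≤ beta z * 1 * ‖v.2‖ ^ 2 := by
          gcongr
          linarith
        _ = beta z * ‖v.2‖ ^ 2 := by ring
    have e4 : 1 / C ≤ 1 := by linarith
    have e5 : (1 - 1 / C) * (1 / C) * (beta z ^ 2 * (z.2.re * v.2.re + z.2.im * v.2.im) ^ 2)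
        ≤ (1 - 1 / C) * 1 * (beta z * ‖v.2‖ ^ 2) := by
      gcongr
    have e6 : 0 ≤ (1 - 1 / C) * (‖v.1‖ ^ 2 / C) := by positivity
    linarith
  have bound : ∀ {f : C2 → ℂ} {y : C2}, ‖f y - f x‖ₑ ≤ metricEDist (metricG (potential C)) x y →
      metricEDist (metricG (potential C)) x y < 1 → ‖f y‖ ≤ ‖f x‖ + 1 := by
    intro f y h1 h2
    have h3 : ‖f y - f x‖ₑ < 1 := lt_of_le_of_lt h1 h2
    rw [← ofReal_norm, ENNReal.ofReal_lt_one] at h3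
    have h4 := norm_sub_norm_le (f y) (f x)
    linarith
  -- On a unit ball the norms of `f₁` and `f₂` grow by at most `1`; the radius results from solving
  -- these two bounds for `|q₁|` and `|q₂|`.
  refine ⟨max ((‖f₁ x‖ + 1) / c) (Real.sqrt (Real.exp ((‖f₂ x‖ + 1) / c))), fun y hy => ?_⟩
  have h₁ := bound (enorm_sub_le_metricEDist hf₁ b₁ x y) hy
  have h₂ := bound (enorm_sub_le_metricEDist hf₂ b₂ x y) hy
  simp only [f₁, f₂, norm_smul, Real.norm_eq_abs, abs_of_pos hc0, Complex.norm_real] at h₁ h₂ ⊢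
  rw [Prod.norm_def]
  refine max_le_max ?_ ?_
  · rw [le_div_iff₀ hc0]
    linarith
  · refine Real.le_sqrt_of_sq_le ?_
    have h3 : Real.log (1 + ‖y.2‖ ^ 2) ≤ (c * |Real.log (1 + ‖x.2‖ ^ 2)| + 1) / c := by
      rw [le_div_iff₀ hc0]
      have := le_abs_self (Real.log (1 + ‖y.2‖ ^ 2))
      nlinarith
    have h4 := (Real.log_le_iff_le_exp (by positivity)).1 h3
    linarith

end GenKahler

end

open GenKahler in
theorem proposition5p5 (C : ℝ) (hC : 1 < C) :
    -- the groupoid form is `t*ω - s*ω` with `ω` inverse to `x ∂_x ∧ ∂_y` where `x ≠ 0`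
    (∀ z : Gpd, z.2.2.1 ≠ 0 → ∀ u v : Gpd,
      groupoidForm z u v =
        meromorphicForm (target z) (fderiv ℂ target z u) (fderiv ℂ target z v)
          - meromorphicForm (source z) (fderiv ℂ source z u) (fderiv ℂ source z v)) ∧
    -- the chart is a Darboux chart
    (∀ z u v : Gpd,
      canonicalForm (darboux z) (fderiv ℂ darboux z u) (fderiv ℂ darboux z v)
        = groupoidForm z u v) ∧
    -- the potential is smooth, with `α = 1 / C` and `β = 1 / (1 + |q₂|²)`
    ContDiff ℝ ∞ (potential C) ∧
    (∀ q : C2, levi (potential C) (1, 0) (1, 0) q = ((1 / C : ℝ) : ℂ)) ∧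
    (∀ q : C2, levi (potential C) (0, 1) (0, 1) q = ((1 / (1 + ‖q.2‖ ^ 2) : ℝ) : ℂ)) ∧
    -- its graph is a brane bisection, and `F = i ∂∂̄K` is a symplectic form
    IsBraneBisection (potential C) ∧
    (∀ q u v : C2, braneForm (potential C) q u v = iddbar (potential C) q u v) ∧
    IsSymplecticForm (formF (potential C)) ∧
    -- `(I₊, I₋, Q, F)`: both complex structures carry the same real Poisson structure `Q`, and
    -- `I₊ - I₋ = Q F`, `F I₊ + I₋* F = 0`
    pullbackPoisson (piPlus (potential C)) = pullbackPoisson (piMinus (potential C)) ∧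
    (∀ q : C2, iPlus (potential C) q - iMinus (potential C) q
      = (pullbackPoisson (piMinus (potential C)) q).comp (formF (potential C) q)) ∧
    (∀ q : C2, (formF (potential C) q).comp (iPlus (potential C) q)
      + (transpose (iMinus (potential C) q)).comp (formF (potential C) q) = 0) ∧
    -- `g = -½ F (I₊ + I₋)` is a Riemannian metric, with the explicit form
    IsRiemannianMetric (metricG (potential C)) ∧
    (∀ q u : C2, ((metricG (potential C) q u u : ℝ) : ℂ) =
      2 * (1 / (C : ℂ) * (u.1 * starRingEnd ℂ u.1)
        + 1 / (1 + (‖q.2‖ : ℂ) ^ 2) * (u.2 * starRingEnd ℂ u.2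
          + Complex.I / (C : ℂ) * starRingEnd ℂ q.2 * u.1 * u.2
          - Complex.I / (C : ℂ) * q.2 * starRingEnd ℂ u.1 * starRingEnd ℂ u.2))) ∧
    -- the data define a generalized Kähler structure on `ℝ⁴`, of symplectic type with form `F`
    IsGeneralizedKahler
      (gualtieriA (metricG (potential C)) (fieldB (potential C))
        (iPlus (potential C)) (iMinus (potential C)))
      (gualtieriB (metricG (potential C)) (fieldB (potential C))
        (iPlus (potential C)) (iMinus (potential C))) ∧
    gualtieriA (metricG (potential C)) (fieldB (potential C))
        (iPlus (potential C)) (iMinus (potential C)) = symplecticGC (formF (potential C)) ∧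
    -- the metric is complete
    IsCompleteMetric (metricG (potential C)) ∧
    -- the Poisson structure is nondegenerate for `q₂ ≠ 0` and vanishes for `q₂ = 0`
    (∀ q : C2, Module.finrank ℝ
        (LinearMap.range (pullbackPoisson (piMinus (potential C)) q).toLinearMap)
      = if q.2 = 0 then 0 else 4) := by
  have hK := (isHermitianPair_potential hC).isGeneralizedKahler (g := metricG (potential C))
    (b := fieldB (potential C)) (fun _ => rfl) (fun _ => rfl) (metricG_pos hC)
  exact ⟨groupoidForm_eq_pullback, canonicalForm_darboux, contDiff_potential C,
    fun q => (levi_potential C q).1, fun q => (levi_potential C q).2.2.2,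
    isBraneBisection_potential C, braneForm_eq_iddbar C, isSymplecticForm_formF hC,
    pullbackPoisson_eq C, iPlus_sub_iMinus C, formF_comp_iPlus hC, hK.1, metricG_eq C, hK.2.1,
    hK.2.2, isCompleteMetric_metricG hC, finrank_range_pullbackPoisson C⟩
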